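/- Conventions. Let $n\ge 1$ and $1<p<\infty$. Cubes in $\mathbb{R}^n$ are nondegenerate, bounded, with edges parallel to the coordinate axes; $l(Q)$ is the side length and $|Q|$ the volume of $Q$; $g_Q=\frac1{|Q|}\int_Q g$ is the average of $g$ over $Q$. For $X\subseteq\mathbb{R}^n$ let $\|g\|_{JN_p(X)}$ be the smallest $K\in[0,\infty]$ such that $$\sum_{i}|Q_i|\Big(\frac1{|Q_i|}\int_{Q_i}|g-g_{Q_i}|\Big)^p\le K^p$$ for all countable collections of pairwise disjoint cubes $Q_i\subset X$. For a bounded cube $Q_0$, $JN_p(Q_0)$ is the set of $g\in L^1(Q_0)$ with $\|g\|_{JN_p(Q_0)}<\infty$, and $VJN_p(Q_0)$ is the set of $g\in JN_p(Q_0)$ such that $$\lim_{a\to0}\ \sup\ \sum_{i}|Q_i|\Big(\frac1{|Q_i|}\int_{Q_i}|g-g_{Q_i}|\Big)^p=0,$$ the supremum being over all countable collections of pairwise disjoint cubes $Q_i\subset Q_0$ with $l(Q_i)\le a$ for all $i$. (In dimension one cubes are intervals.) On the whole space, $JN_p=JN_p(\mathbb{R}^n)$ is the set of $g\in L^1_{loc}(\mathbb{R}^n)$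 with $\|g\|_{JN_p(\mathbb{R}^n)}<\infty$; $VJN_p$ is the closure in $JN_p$, with respect to this seminorm, of $\{g\in C^\infty(\mathbb{R}^n): |\nabla g|\in L^p(\mathbb{R}^n)\}\cap JN_p$; and $CJN_p$ is the closure of $C_c^\infty(\mathbb{R}^n)$ in $JN_p$. Lemma. Let $n\ge1$, $1<p<\infty$, $L>0$, $I=[0,L]$ and $f\in L^1(I)$ real-valued. Define $\hat f:\mathbb{R}^n\to\mathbb{R}$ by $$\hat f(x_1,\dots,x_n)=\begin{cases} f(x_1) & \text{if } 0\le x_i\le L \text{ for all } i,\\ f_I=\frac1L\int_0^L f & \text{elsewhere.}\end{cases}$$ (1) If $\hat f\in VJN_p$, then $f\in VJN_p(I)$. (2) If $f\in VJN_p(I)$ and $$\lim_{a\to0}\ \sup_{J\subset I,\ 0<|J|\le a}|J|^{1-p}\Big(\int_J|f|\Big)^p=0,$$ where the supremum is over all intervals $J\subset I$ with $0<|J|\le a$, then $\hat f\in CJN_p$. -/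

import Mathlib

open MeasureTheory Filter Topology
open scoped ENNReal ContDiff

noncomputable section

namespace JohnNirenberg

/-- A (nondegenerate) cube in `ℝⁿ` with edges parallel to the coordinate axes, given by its lower
corner and its side length. -/
structure Cube (n : ℕ) where
  corner : Fin n → ℝ
  side : ℝ
  side_pos : 0 < side

/-- The point set of a cube: the half-open box `∏ i, [aᵢ, aᵢ + ℓ)`.
Allowing also other choices of the faces (closed or open cubes) would not change any notion below:
averages ignore faces; two half-open boxes are disjoint as soon as their interiors are disjoint;
and a half-open box lies in a closed cube as soon as its interior does. -/
def Cube.toSet {n : ℕ} (Q : Cube n) : Set (Fin n → ℝ) :=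
  Set.pi Set.univ (fun i => Set.Ico (Q.corner i) (Q.corner i + Q.side))

/-- The mean oscillation `⨍_Q |f - f_Q|`. -/
def meanOsc {n : ℕ} (f : (Fin n → ℝ) → ℝ) (Q : Cube n) : ℝ :=
  ⨍ x in Q.toSet, |f x - ⨍ y in Q.toSet, f y|

/-- The sum `∑ |Q| (⨍_Q |f - f_Q|)ᵖ` over a collection `S` of cubes. -/
def jnSum {n : ℕ} (p : ℝ) (f : (Fin n → ℝ) → ℝ) (S : Set (Cube n)) : ℝ≥0∞ :=
  ∑' Q : S, volume (Q : Cube n).toSet * ENNReal.ofReal (meanOsc f (Q : Cube n)) ^ p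

/-- `S` is a countable (finite or infinite) collection of pairwise disjoint cubes contained
in `X`. -/
def IsDisjointFamily {n : ℕ} (X : Set (Fin n → ℝ)) (S : Set (Cube n)) : Prop :=
  S.Countable ∧ S.PairwiseDisjoint Cube.toSet ∧ ∀ Q ∈ S, Q.toSet ⊆ X

/-- The `JN_p(X)` seminorm: the smallest `K ∈ [0, ∞]` with `∑ |Q| (⨍_Q |f - f_Q|)ᵖ ≤ Kᵖ` for all
countable collections of pairwise disjoint cubes in `X`. -/
def jnNorm {n : ℕ} (p : ℝ) (X : Set (Fin n → ℝ)) (f : (Fin n → ℝ) → ℝ) : ℝ≥0∞ :=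
  ⨆ (S : Set (Cube n)) (_ : IsDisjointFamily X S), jnSum p f S ^ (1 / p)

/-- `f ∈ JN_p(Q₀)` for a bounded cube `Q₀`. -/
def MemJNOn {n : ℕ} (p : ℝ) (Q₀ : Set (Fin n → ℝ)) (f : (Fin n → ℝ) → ℝ) : Prop :=
  IntegrableOn f Q₀ ∧ jnNorm p Q₀ f < ⊤

/-- `f ∈ VJN_p(Q₀)` for a bounded cube `Q₀`. -/
def MemVJNOn {n : ℕ} (p : ℝ) (Q₀ : Set (Fin n → ℝ)) (f : (Fin n → ℝ) → ℝ) : Prop :=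
  MemJNOn p Q₀ f ∧
    Tendsto (fun a : ℝ => ⨆ (S : Set (Cube n)) (_ : IsDisjointFamily Q₀ S)
      (_ : ∀ Q ∈ S, Q.side ≤ a), jnSum p f S) (𝓝[>] 0) (𝓝 0)

/-- `f ∈ JN_p(ℝⁿ)`. -/
def MemJN {n : ℕ} (p : ℝ) (f : (Fin n → ℝ) → ℝ) : Prop :=
  LocallyIntegrable f ∧ jnNorm p Set.univ f < ⊤

/-- `f` lies in the closure of `A ∩ JN_p(ℝⁿ)` in `JN_p(ℝⁿ)`. -/
def MemJNClosure {n : ℕ} (p : ℝ) (A : Set ((Fin n → ℝ) → ℝ)) (f : (Fin n → ℝ) → ℝ) : Prop :=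
  MemJN p f ∧ ∀ ε : ℝ≥0∞, 0 < ε →
    ∃ g ∈ A, MemJN p g ∧ jnNorm p Set.univ (fun x => f x - g x) < ε

/-- The Euclidean length `|∇g(x)|` of the gradient. -/
def gradNorm {n : ℕ} (g : (Fin n → ℝ) → ℝ) (x : Fin n → ℝ) : ℝ :=
  √(∑ i, (fderiv ℝ g x (Pi.single i 1)) ^ 2)

/-- `D_p(ℝⁿ)`: the smooth functions whose gradient is in `L^p(ℝⁿ)`. -/
def Dp (n : ℕ) (p : ℝ) : Set ((Fin n → ℝ) → ℝ) :=
  {g | ContDiff ℝ ∞ g ∧ MemLp (gradNorm g) (ENNReal.ofReal p) volume}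

/-- `f ∈ VJN_p(ℝⁿ)`: the closure of `D_p(ℝⁿ) ∩ JN_p` in `JN_p`. -/
def MemVJN {n : ℕ} (p : ℝ) (f : (Fin n → ℝ) → ℝ) : Prop :=
  MemJNClosure p (Dp n p) f

/-- `f ∈ CJN_p(ℝⁿ)`: the closure of `C_c^∞(ℝⁿ)` in `JN_p`. -/
def MemCJN {n : ℕ} (p : ℝ) (f : (Fin n → ℝ) → ℝ) : Prop :=
  MemJNClosure p {g | ContDiff ℝ ∞ g ∧ HasCompactSupport g} f

open Classical in
/-- The extension `f̂` of `f : [0, L] → ℝ` to `ℝⁿ`: it is `f(x₁)` on `[0, L]ⁿ` and the average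
`f_I`, `I = [0, L]`, elsewhere. -/
def hat (n : ℕ) [NeZero n] (L : ℝ) (f : ℝ → ℝ) (x : Fin n → ℝ) : ℝ :=
  if ∀ i, 0 ≤ x i ∧ x i ≤ L then f (x 0) else ⨍ t in Set.Icc 0 L, f t

/-- `f ∈ VJN_p(I)`, `I = [0, L]`: the one-dimensional case of `MemVJNOn`, with `ℝ` identified
with `ℝ¹`. -/
def MemVJNInterval (p L : ℝ) (f : ℝ → ℝ) : Prop :=
  MemVJNOn (n := 1) p {x | ∀ i, 0 ≤ x i ∧ x i ≤ L} (fun x => f (x 0))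

/-- `lim_{a → 0} sup |J|^{1-p} (∫_J |f|)ᵖ = 0`, the supremum being over the intervals
`J = [s, t] ⊆ [0, L]` with `0 < |J| ≤ a`. -/
def SmallOnShortIntervals (p L : ℝ) (f : ℝ → ℝ) : Prop :=
  Tendsto (fun a : ℝ => ⨆ (s : ℝ) (t : ℝ) (_ : 0 ≤ s ∧ s < t ∧ t ≤ L ∧ t - s ≤ a),
    ENNReal.ofReal ((t - s) ^ (1 - p) * (∫ x in Set.Icc s t, |f x|) ^ p)) (𝓝[>] 0) (𝓝 0)

end JohnNirenberg

end

/-!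
Both parts compare sums over cubes in `ℝⁿ` with sums over intervals.

*Restriction.* An interval `J ⊆ [0, L]` of length `l` is the base of a stack of `⌊L / l⌋ ^ (n - 1)`
disjoint cubes `J × K` of side `l` in `[0, L]ⁿ`, on which `f̂` has the mean oscillation of `f` on
`J`. Hence sums for `f` over disjoint intervals are bounded by a constant times sums for `f̂` over
disjoint cubes of the same sides (`exists_stacked_family`). If `f̂` is close to a continuous
function, the latter are small for small cubes, by uniform continuity on `[0, L]ⁿ`
(`exists_forall_jnSum_le_of_continuous`).

*Extension.* Cut `[0, L]` into short cells `I j` and subtract from `f` the step function of its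
averages over the cells. The step function minus `f_I` extends by zero to an element of `L^p`; this
space embeds in `JN_p`, constants do not matter, and smooth functions with compact support are
dense in it. So it suffices that the extension by zero `F` of the difference `v` has small seminorm
(`jnSum_columnExt_sub_stepAverage_le`). For cubes inside one of the slabs `I j × [0, L)^(n - 1)`,
the oscillation of `F` is that of `f` on short intervals, and Fubini's theorem bounds the sum by
the one-dimensional modulus of vanishing (`jnSum_comp_zero_le_jnModulus`). For all other cubes the
oscillation is replaced by the average of `|F|`. As in the equivalence of Campanato and Morrey
spaces, telescoping over doublings of an interval `K ⊆ I j` gives `|K|^(1 - p) (∫_K |v|)ᵖ ≤ C A j`,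
where `A j` is the largest value of `|K'| (⨍_K' |f - f_K'|)ᵖ` for `K' ⊆ I j`
(`lintegral_sub_average_rpow_le`). With this a cube `Q` that lies in no slab contributes at most
`C ∑ A j σ_j(Q)`, where `σ_j` is the surface measure `slabBoundary` of the `j`-th slab
(`volume_mul_average_columnExt_rpow_le`). As the cubes are disjoint and `σ_j` has mass
`2 n L^(n - 1)`, these contributions sum up to `C ∑ A j`, and `∑ A j` is again at most the modulus
of vanishing, since one interval is taken from each cell (`sum_maxIntervalEnergy_le_jnModulus`).
-/

noncomputable section

namespace JohnNirenberg

section Cubes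

variable {n : ℕ}

/-! ### Cubes and their energies -/

/-- The contribution `|Q| (⨍_Q |g - g_Q|)ᵖ` of a single cube to `jnSum`. -/
def cubeEnergy (p : ℝ) (g : (Fin n → ℝ) → ℝ) (Q : Cube n) : ℝ≥0∞ :=
  volume Q.toSet * ENNReal.ofReal (meanOsc g Q) ^ p

lemma jnSum_eq_tsum_cubeEnergy (p : ℝ) (g : (Fin n → ℝ) → ℝ) (S : Set (Cube n)) :
    jnSum p g S = ∑' Q : S, cubeEnergy p g (Q : Cube n) := rfl

lemma Cube.measurableSet_toSet (Q : Cube n) : MeasurableSet Q.toSet :=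
  MeasurableSet.univ_pi fun _ => measurableSet_Ico

lemma Cube.volume_toSet (Q : Cube n) : volume Q.toSet = ENNReal.ofReal Q.side ^ n := by
  simp [Cube.toSet, Real.volume_pi_Ico]

lemma Cube.volume_toSet_ne_zero (Q : Cube n) : volume Q.toSet ≠ 0 := by
  rw [Q.volume_toSet]
  exact pow_ne_zero _ (by simpa using Q.side_pos)

lemma Cube.volume_toSet_ne_top (Q : Cube n) : volume Q.toSet ≠ ⊤ := by
  rw [Q.volume_toSet]
  exact ENNReal.pow_ne_top ENNReal.ofReal_ne_top

lemma Cube.corner_mem (Q : Cube n) : Q.corner ∈ Q.toSet :=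
  fun _ _ => ⟨le_rfl, by linarith [Q.side_pos]⟩

lemma Cube.toSet_subset_Icc (Q : Cube n) :
    Q.toSet ⊆ Set.Icc Q.corner (fun i => Q.corner i + Q.side) :=
  fun _ hx => ⟨fun i => (hx i trivial).1, fun i => (hx i trivial).2.le⟩

lemma Cube.integrableOn_of_locallyIntegrable (Q : Cube n) {g : (Fin n → ℝ) → ℝ}
    (hg : LocallyIntegrable g) : IntegrableOn g Q.toSet :=
  (hg.integrableOn_isCompact isCompact_Icc).mono_set Q.toSet_subset_Icc

/-- A bound for a coordinate on the half-open cube also holds on the missing upper face. -/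
lemma Cube.corner_add_side_le (Q : Cube n) {i : Fin n} {b : ℝ} (h : ∀ x ∈ Q.toSet, x i ≤ b) :
    Q.corner i + Q.side ≤ b := by
  by_contra! hb
  have hs := Q.side_pos
  have h0 := h Q.corner Q.corner_mem
  have := h (fun j => Q.corner j + (b - Q.corner i + Q.side) / 2) (fun j _ =>
    ⟨by linarith, by linarith⟩)
  linarith

/-- Families of cubes may be indexed by any type, since disjoint cubes are distinct. -/
lemma tsum_cubeEnergy_eq_jnSum {ι : Type*} (p : ℝ) (g : (Fin n → ℝ) → ℝ) (Q : ι → Cube n)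
    (hd : Pairwise (Function.onFun Disjoint fun i => (Q i).toSet)) :
    ∑' i, cubeEnergy p g (Q i) = jnSum p g (Set.range Q) := by
  have hinj : Function.Injective Q := by
    intro i j hij
    by_contra hne
    have h := hd hne
    simp only [Function.onFun, hij] at h
    exact Set.disjoint_left.1 h (Q j).corner_mem (Q j).corner_mem
  rw [jnSum_eq_tsum_cubeEnergy]
  exact ((Equiv.ofInjective Q hinj).tsum_eq
    (fun R : Set.range Q => cubeEnergy p g (R : Cube n))).symm ▸ rfl

lemma isDisjointFamily_range {ι : Type*} [Countable ι] {X : Set (Fin n → ℝ)} (Q : ι → Cube n)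
    (hd : Pairwise (Function.onFun Disjoint fun i => (Q i).toSet)) (hX : ∀ i, (Q i).toSet ⊆ X) :
    IsDisjointFamily X (Set.range Q) := by
  refine ⟨Set.countable_range Q, ?_, ?_⟩
  · rintro _ ⟨i, rfl⟩ _ ⟨j, rfl⟩ hij
    exact hd (fun h => hij (by rw [h]))
  · rintro _ ⟨i, rfl⟩
    exact hX i

lemma jnNorm_le {p : ℝ} (hp : 0 < p) {X : Set (Fin n → ℝ)} {g : (Fin n → ℝ) → ℝ} {K : ℝ≥0∞}
    (h : ∀ S, IsDisjointFamily X S → jnSum p g S ≤ K) : jnNorm p X g ≤ K ^ (1 / p) :=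
  iSup₂_le fun S hS => ENNReal.rpow_le_rpow (h S hS) (by positivity)

lemma jnSum_le_jnNorm_rpow {p : ℝ} (hp : 0 < p) {X : Set (Fin n → ℝ)} {g : (Fin n → ℝ) → ℝ}
    {S : Set (Cube n)} (hS : IsDisjointFamily X S) : jnSum p g S ≤ jnNorm p X g ^ p := by
  rw [← ENNReal.rpow_inv_le_iff hp, ← one_div]
  exact le_iSup₂_of_le S hS le_rfl

/-! ### Elementary estimates of the mean oscillation -/

lemma meanOsc_nonneg (g : (Fin n → ℝ) → ℝ) (Q : Cube n) : 0 ≤ meanOsc g Q := by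
  unfold meanOsc
  rw [setAverage_eq]
  exact smul_nonneg (by positivity) (integral_nonneg fun _ => abs_nonneg _)

lemma meanOsc_congr {g h : (Fin n → ℝ) → ℝ} {Q : Cube n}
    (H : ∀ᵐ x, x ∈ Q.toSet → g x = h x) : meanOsc g Q = meanOsc h Q := by
  unfold meanOsc
  rw [setAverage_congr_fun Q.measurableSet_toSet H]
  refine setAverage_congr_fun Q.measurableSet_toSet ?_
  filter_upwards [H] with x hx hxQ
  rw [hx hxQ]

lemma cubeEnergy_congr {p : ℝ} {g h : (Fin n → ℝ) → ℝ} {Q : Cube n}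
    (H : ∀ᵐ x, x ∈ Q.toSet → g x = h x) : cubeEnergy p g Q = cubeEnergy p h Q := by
  rw [cubeEnergy, cubeEnergy, meanOsc_congr H]

lemma jnSum_congr {p : ℝ} {g h : (Fin n → ℝ) → ℝ} (H : g =ᵐ[volume] h) (S : Set (Cube n)) :
    jnSum p g S = jnSum p h S := by
  simp only [jnSum_eq_tsum_cubeEnergy]
  refine tsum_congr fun Q => cubeEnergy_congr ?_
  filter_upwards [H] with x hx _ using hx

lemma Cube.measureReal_pos (Q : Cube n) : 0 < volume.real Q.toSet :=
  ENNReal.toReal_pos Q.volume_toSet_ne_zero Q.volume_toSet_ne_top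

lemma Cube.setAverage_const (Q : Cube n) (c : ℝ) : ⨍ _ in Q.toSet, c = c :=
  MeasureTheory.setAverage_const Q.volume_toSet_ne_zero Q.volume_toSet_ne_top c

lemma Cube.setAverage_add (Q : Cube n) {g h : (Fin n → ℝ) → ℝ} (hg : IntegrableOn g Q.toSet)
    (hh : IntegrableOn h Q.toSet) :
    ⨍ x in Q.toSet, (g x + h x) = (⨍ x in Q.toSet, g x) + ⨍ x in Q.toSet, h x := by
  rw [setAverage_eq, setAverage_eq, setAverage_eq, integral_add hg hh, smul_add]

lemma Cube.setAverage_mono (Q : Cube n) {g h : (Fin n → ℝ) → ℝ} (hg : IntegrableOn g Q.toSet)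
    (hh : IntegrableOn h Q.toSet) (H : ∀ x ∈ Q.toSet, g x ≤ h x) :
    ⨍ x in Q.toSet, g x ≤ ⨍ x in Q.toSet, h x := by
  rw [setAverage_eq, setAverage_eq]
  exact smul_le_smul_of_nonneg_left (setIntegral_mono_on hg hh Q.measurableSet_toSet H)
    (by positivity)

lemma Cube.integrableOn_const (Q : Cube n) (c : ℝ) : IntegrableOn (fun _ => c) Q.toSet :=
  MeasureTheory.integrableOn_const Q.volume_toSet_ne_top

lemma Cube.integrableOn_abs_sub_const (Q : Cube n) {g : (Fin n → ℝ) → ℝ}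
    (hg : IntegrableOn g Q.toSet) (c : ℝ) : IntegrableOn (fun x => |g x - c|) Q.toSet :=
  (Integrable.sub hg (Q.integrableOn_const c)).abs

lemma meanOsc_add_le {g h : (Fin n → ℝ) → ℝ} {Q : Cube n} (hg : IntegrableOn g Q.toSet)
    (hh : IntegrableOn h Q.toSet) :
    meanOsc (fun x => g x + h x) Q ≤ meanOsc g Q + meanOsc h Q := by
  unfold meanOsc
  rw [Q.setAverage_add hg hh, ← Q.setAverage_add (Q.integrableOn_abs_sub_const hg _)
    (Q.integrableOn_abs_sub_const hh _)]
  refine Q.setAverage_mono (Q.integrableOn_abs_sub_const (Integrable.add hg hh) _)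
    ((Q.integrableOn_abs_sub_const hg _).add (Q.integrableOn_abs_sub_const hh _)) fun x _ => ?_
  rw [add_sub_add_comm]
  exact abs_add_le _ _

lemma meanOsc_add_const {g : (Fin n → ℝ) → ℝ} {Q : Cube n} (hg : IntegrableOn g Q.toSet)
    (c : ℝ) : meanOsc (fun x => g x + c) Q = meanOsc g Q := by
  unfold meanOsc
  rw [Q.setAverage_add hg (Q.integrableOn_const c), Q.setAverage_const]
  simp only [add_sub_add_right_eq_sub]

lemma abs_setAverage_le (g : (Fin n → ℝ) → ℝ) (Q : Cube n) :
    |⨍ x in Q.toSet, g x| ≤ ⨍ x in Q.toSet, |g x| := by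
  rw [setAverage_eq, setAverage_eq, smul_eq_mul, smul_eq_mul, abs_mul,
    abs_of_nonneg (by positivity : (0 : ℝ) ≤ (volume.real Q.toSet)⁻¹)]
  gcongr
  exact abs_integral_le_integral_abs

lemma meanOsc_le_two_mul {g : (Fin n → ℝ) → ℝ} {Q : Cube n} (hg : IntegrableOn g Q.toSet) :
    meanOsc g Q ≤ 2 * ⨍ x in Q.toSet, |g x| := by
  have h1 : meanOsc g Q ≤ ⨍ x in Q.toSet, (|g x| + |⨍ y in Q.toSet, g y|) := by
    refine Q.setAverage_mono (Q.integrableOn_abs_sub_const hg _)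
      (Integrable.add hg.abs (Q.integrableOn_const _)) fun x _ => abs_sub _ _
  rw [Q.setAverage_add hg.abs (Q.integrableOn_const _), Q.setAverage_const] at h1
  linarith [abs_setAverage_le g Q]

lemma Cube.ofReal_setAverage_abs (Q : Cube n) {g : (Fin n → ℝ) → ℝ}
    (hg : IntegrableOn g Q.toSet) :
    ENNReal.ofReal (⨍ x in Q.toSet, |g x|) = (volume Q.toSet)⁻¹ * ∫⁻ x in Q.toSet, ‖g x‖ₑ := by
  rw [setAverage_eq, smul_eq_mul, ENNReal.ofReal_mul (by positivity),
    ENNReal.ofReal_inv_of_pos Q.measureReal_pos, ofReal_measureReal Q.volume_toSet_ne_top]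
  congr 1
  exact ofReal_integral_norm_eq_lintegral_enorm hg

lemma cubeEnergy_le_two_rpow_mul {p : ℝ} (hp : 0 ≤ p) {g : (Fin n → ℝ) → ℝ} {Q : Cube n}
    (hg : IntegrableOn g Q.toSet) :
    cubeEnergy p g Q ≤
      2 ^ p * (volume Q.toSet * ((volume Q.toSet)⁻¹ * ∫⁻ x in Q.toSet, ‖g x‖ₑ) ^ p) := by
  rw [← Q.ofReal_setAverage_abs hg, mul_left_comm, ← ENNReal.mul_rpow_of_nonneg _ _ hp,
    cubeEnergy]
  gcongr
  rw [show (2 : ℝ≥0∞) = ENNReal.ofReal 2 by simp, ← ENNReal.ofReal_mul (by norm_num)]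
  exact ENNReal.ofReal_le_ofReal (meanOsc_le_two_mul hg)

lemma cubeEnergy_add_le {p : ℝ} (hp : 1 ≤ p) {g h : (Fin n → ℝ) → ℝ} {Q : Cube n}
    (hg : IntegrableOn g Q.toSet) (hh : IntegrableOn h Q.toSet) :
    cubeEnergy p (fun x => g x + h x) Q ≤ 2 ^ (p - 1) * (cubeEnergy p g Q + cubeEnergy p h Q) := by
  unfold cubeEnergy
  rw [← mul_add, mul_left_comm]
  gcongr
  refine le_trans ?_ (ENNReal.rpow_add_le_mul_rpow_add_rpow _ _ hp)
  rw [← ENNReal.ofReal_add (meanOsc_nonneg _ _) (meanOsc_nonneg _ _)]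
  exact ENNReal.rpow_le_rpow (ENNReal.ofReal_le_ofReal (meanOsc_add_le hg hh)) (by linarith)

lemma jnSum_add_le {p : ℝ} (hp : 1 ≤ p) {g h : (Fin n → ℝ) → ℝ} {S : Set (Cube n)}
    (hg : ∀ Q ∈ S, IntegrableOn g Q.toSet) (hh : ∀ Q ∈ S, IntegrableOn h Q.toSet) :
    jnSum p (fun x => g x + h x) S ≤ 2 ^ (p - 1) * (jnSum p g S + jnSum p h S) := by
  simp only [jnSum_eq_tsum_cubeEnergy]
  rw [← ENNReal.tsum_add, ← ENNReal.tsum_mul_left]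
  exact ENNReal.tsum_le_tsum fun Q => cubeEnergy_add_le hp (hg Q Q.2) (hh Q Q.2)

lemma jnSum_add_const (p : ℝ) {g : (Fin n → ℝ) → ℝ} {S : Set (Cube n)}
    (hg : ∀ Q ∈ S, IntegrableOn g Q.toSet) (c : ℝ) :
    jnSum p (fun x => g x + c) S = jnSum p g S := by
  simp only [jnSum_eq_tsum_cubeEnergy]
  refine tsum_congr fun Q => ?_
  rw [cubeEnergy, cubeEnergy, meanOsc_add_const (hg Q Q.2)]

lemma IsDisjointFamily.tsum_measure_le {X : Set (Fin n → ℝ)} {S : Set (Cube n)}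
    (hS : IsDisjointFamily X S) (μ : Measure (Fin n → ℝ)) :
    ∑' Q : S, μ (Q : Cube n).toSet ≤ μ X := by
  have := hS.1.to_subtype
  refine (tsum_meas_le_meas_iUnion_of_disjoint μ (fun Q : S => (Q : Cube n).measurableSet_toSet)
    ?_).trans (measure_mono (Set.iUnion_subset fun Q => hS.2.2 Q Q.2))
  intro Q R hQR
  exact hS.2.1 Q.2 R.2 (fun h => hQR (Subtype.ext h))

/-- Hölder's inequality on a cube, in the form `|Q| (⨍_Q φ)ᵖ ≤ ∫_Q φᵖ`. -/
lemma Cube.volume_mul_average_rpow_le (Q : Cube n) {p : ℝ} (hp : 1 < p) {φ : (Fin n → ℝ) → ℝ≥0∞}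
    (hφ : AEMeasurable φ (volume.restrict Q.toSet)) :
    volume Q.toSet * ((volume Q.toSet)⁻¹ * ∫⁻ x in Q.toSet, φ x) ^ p
      ≤ ∫⁻ x in Q.toSet, φ x ^ p := by
  have h0 := Q.volume_toSet_ne_zero
  have ht := Q.volume_toSet_ne_top
  have hpq := Real.HolderConjugate.conjExponent hp
  have H := ENNReal.lintegral_mul_le_Lp_mul_Lq (volume.restrict Q.toSet) hpq hφ
    (aemeasurable_const (b := (1 : ℝ≥0∞)))
  simp only [Pi.mul_apply, mul_one, ENNReal.one_rpow, lintegral_const, one_mul,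
    Measure.restrict_apply_univ] at H
  set V := volume Q.toSet
  have h1 : (1 / p.conjExponent) * p = p - 1 := by
    rw [Real.conjExponent]
    field_simp
  calc V * (V⁻¹ * ∫⁻ x in Q.toSet, φ x) ^ p
      ≤ V * (V⁻¹ * ((∫⁻ x in Q.toSet, φ x ^ p) ^ (1 / p) * V ^ (1 / p.conjExponent))) ^ p := by
        gcongr
    _ = (V * (V⁻¹ ^ p * V ^ (p - 1))) * ∫⁻ x in Q.toSet, φ x ^ p := by
        rw [ENNReal.mul_rpow_of_nonneg _ _ (by linarith),
          ENNReal.mul_rpow_of_nonneg _ _ (by linarith), ← ENNReal.rpow_mul, ← ENNReal.rpow_mul, h1,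
          one_div_mul_cancel (by linarith), ENNReal.rpow_one]
        ring
    _ = ∫⁻ x in Q.toSet, φ x ^ p := by
        rw [ENNReal.inv_rpow, ← ENNReal.rpow_neg, ← ENNReal.rpow_add _ _ h0 ht]
        rw [show -p + (p - 1) = -1 by ring, ENNReal.rpow_neg_one, ENNReal.mul_inv_cancel h0 ht,
          one_mul]

/-- `L^p` embeds into `JN_p`. -/
lemma jnSum_le_lintegral_rpow {p : ℝ} (hp : 1 < p) {X : Set (Fin n → ℝ)} {g : (Fin n → ℝ) → ℝ}
    (hg : LocallyIntegrable g) {S : Set (Cube n)} (hS : IsDisjointFamily X S) :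
    jnSum p g S ≤ 2 ^ p * ∫⁻ x, ‖g x‖ₑ ^ p := by
  have hc := hS.1.to_subtype
  rw [jnSum_eq_tsum_cubeEnergy]
  calc ∑' Q : S, cubeEnergy p g (Q : Cube n)
      ≤ ∑' Q : S, 2 ^ p * ∫⁻ x in (Q : Cube n).toSet, ‖g x‖ₑ ^ p := by
        refine ENNReal.tsum_le_tsum fun Q => ?_
        have hi := (Q : Cube n).integrableOn_of_locallyIntegrable hg
        refine (cubeEnergy_le_two_rpow_mul (by linarith) hi).trans ?_
        gcongr
        exact Cube.volume_mul_average_rpow_le _ hp hi.aestronglyMeasurable.enorm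
    _ ≤ 2 ^ p * ∫⁻ x, ‖g x‖ₑ ^ p := by
        rw [ENNReal.tsum_mul_left]
        gcongr
        rw [← lintegral_iUnion (fun Q : S => (Q : Cube n).measurableSet_toSet)]
        · exact setLIntegral_le_lintegral _ _
        · intro Q R hQR
          exact hS.2.1 Q.2 R.2 (fun h => hQR (Subtype.ext h))

end Cubes

/-! ### Functions of the first coordinate -/

section Projection

variable {n : ℕ} [NeZero n]

lemma map_eval_zero_restrict_pi (t : Fin n → Set ℝ) :
    Measure.map (fun x : Fin n → ℝ => x 0) (volume.restrict (Set.univ.pi t)) =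
      (∏ k ∈ Finset.univ.erase 0, volume (t k)) • volume.restrict (t 0) := by
  rw [volume_pi, Measure.restrict_pi_pi]
  have := Measure.pi_map_eval (fun k => (volume : Measure ℝ).restrict (t k)) (0 : Fin n)
  simpa [Function.eval] using this

lemma lintegral_pi_comp_zero (t : Fin n → Set ℝ) {φ : ℝ → ℝ≥0∞}
    (hφ : AEMeasurable φ (volume.restrict (t 0))) :
    ∫⁻ x in Set.univ.pi t, φ (x 0) =
      (∏ k ∈ Finset.univ.erase 0, volume (t k)) * ∫⁻ x in t 0, φ x := by
  have h := map_eval_zero_restrict_pi t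
  rw [← lintegral_map' (g := fun x : Fin n → ℝ => x 0) (f := φ) _
    (measurable_pi_apply 0).aemeasurable, h, lintegral_smul_measure, smul_eq_mul]
  rw [h]
  exact hφ.smul_measure _

lemma integral_pi_comp_zero (t : Fin n → Set ℝ) {φ : ℝ → ℝ}
    (hφ : AEStronglyMeasurable φ (volume.restrict (t 0))) :
    ∫ x in Set.univ.pi t, φ (x 0) =
      (∏ k ∈ Finset.univ.erase 0, volume (t k)).toReal * ∫ x in t 0, φ x := by
  have h := map_eval_zero_restrict_pi t
  rw [← integral_map (φ := fun x : Fin n → ℝ => x 0) (f := φ)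
    (measurable_pi_apply 0).aemeasurable, h,
    integral_smul_measure, smul_eq_mul]
  rw [h]
  exact hφ.smul_measure _

lemma integrableOn_pi_comp_zero {t : Fin n → Set ℝ} (ht : ∀ k, volume (t k) ≠ ⊤) {φ : ℝ → ℝ}
    (hφ : IntegrableOn φ (t 0)) : IntegrableOn (fun x : Fin n → ℝ => φ (x 0)) (Set.univ.pi t) := by
  refine Integrable.comp_measurable (f := fun x : Fin n → ℝ => x 0) (g := φ) ?_ (by fun_prop)
  rw [map_eval_zero_restrict_pi]
  exact hφ.smul_measure (ENNReal.prod_ne_top fun k _ => ht k)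

lemma Cube.setAverage_comp_zero (Q : Cube n) {φ : ℝ → ℝ}
    (hφ : IntegrableOn φ (Set.Ico (Q.corner 0) (Q.corner 0 + Q.side))) :
    ⨍ x in Q.toSet, φ (x 0) = ⨍ x in Set.Ico (Q.corner 0) (Q.corner 0 + Q.side), φ x := by
  have h1 : (∏ k ∈ Finset.univ.erase (0 : Fin n),
      volume (Set.Ico (Q.corner k) (Q.corner k + Q.side))).toReal = Q.side ^ (n - 1) := by
    simp [Q.side_pos.le, Finset.card_erase_of_mem]
  have h2 : volume.real Q.toSet = Q.side * Q.side ^ (n - 1) := by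
    rw [measureReal_def, Q.volume_toSet, ENNReal.toReal_pow, ENNReal.toReal_ofReal Q.side_pos.le,
      mul_pow_sub_one (NeZero.ne n)]
  have h3 := integral_pi_comp_zero (fun k => Set.Ico (Q.corner k) (Q.corner k + Q.side))
    hφ.aestronglyMeasurable
  have hs := Q.side_pos
  rw [setAverage_eq, setAverage_eq, h2]
  change _ • ∫ x in Set.univ.pi _, _ = _
  rw [h3, h1]
  simp only [smul_eq_mul, measureReal_def, Real.volume_Ico, add_sub_cancel_left,
    ENNReal.toReal_ofReal hs.le]
  have : Q.side ^ (n - 1) ≠ 0 := by positivity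
  field_simp

end Projection

/-- The mean oscillation of a function of one variable on the interval `[s, t)`. -/
def intervalOsc (u : ℝ → ℝ) (s t : ℝ) : ℝ :=
  ⨍ x in Set.Ico s t, |u x - ⨍ y in Set.Ico s t, u y|

/-- The contribution `|J| (⨍_J |u - u_J|)ᵖ` of the interval `J = [s, t)`. -/
def intervalEnergy (p : ℝ) (u : ℝ → ℝ) (s t : ℝ) : ℝ≥0∞ :=
  ENNReal.ofReal (t - s) * ENNReal.ofReal (intervalOsc u s t) ^ p

lemma meanOsc_comp_zero {n : ℕ} [NeZero n] {u : ℝ → ℝ} {Q : Cube n}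
    (hu : IntegrableOn u (Set.Ico (Q.corner 0) (Q.corner 0 + Q.side))) :
    meanOsc (fun x => u (x 0)) Q = intervalOsc u (Q.corner 0) (Q.corner 0 + Q.side) := by
  unfold meanOsc intervalOsc
  rw [Q.setAverage_comp_zero hu]
  exact Q.setAverage_comp_zero
    (φ := fun x => |u x - ⨍ y in Set.Ico (Q.corner 0) (Q.corner 0 + Q.side), u y|)
    (Integrable.sub hu (integrableOn_const (by simp))).abs

lemma cubeEnergy_comp_zero (p : ℝ) {n : ℕ} [NeZero n] {u : ℝ → ℝ} {Q : Cube n}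
    (hu : IntegrableOn u (Set.Ico (Q.corner 0) (Q.corner 0 + Q.side))) :
    cubeEnergy p (fun x => u (x 0)) Q =
      ENNReal.ofReal Q.side ^ (n - 1) *
        intervalEnergy p u (Q.corner 0) (Q.corner 0 + Q.side) := by
  rw [cubeEnergy, intervalEnergy, meanOsc_comp_zero hu, Q.volume_toSet, add_sub_cancel_left,
    ← mul_assoc, pow_sub_one_mul (NeZero.ne n)]

/-! ### Morrey bounds from oscillation bounds on an interval -/

section Campanato

variable {u : ℝ → ℝ} {c d : ℝ}

lemma sub_mul_setAverage_Ico {s t : ℝ} (hst : s < t) (φ : ℝ → ℝ) :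
    (t - s) * ⨍ x in Set.Ico s t, φ x = ∫ x in Set.Ico s t, φ x := by
  have : t - s ≠ 0 := (sub_pos.2 hst).ne'
  rw [setAverage_eq, smul_eq_mul, measureReal_def, Real.volume_Ico,
    ENNReal.toReal_ofReal (sub_pos.2 hst).le, mul_inv_cancel_left₀ this]

lemma setIntegral_Ico_const {s t : ℝ} (hst : s < t) (k : ℝ) :
    ∫ _ in Set.Ico s t, k = (t - s) * k := by
  simp [hst.le]

lemma sub_mul_abs_average_sub_le {s t s' t' A : ℝ} (hst : s < t) (hs : s' ≤ s) (ht : t ≤ t')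
    (hu : IntegrableOn u (Set.Ico s' t')) :
    (t - s) * |(⨍ x in Set.Ico s t, u x) - A| ≤ ∫ x in Set.Ico s' t', |u x - A| := by
  have hsub : Set.Ico s t ⊆ Set.Ico s' t' := Set.Ico_subset_Ico hs ht
  have hi : IntegrableOn (fun x => u x - A) (Set.Ico s' t') :=
    Integrable.sub hu (integrableOn_const (by simp))
  have h0 : (0 : ℝ) < t - s := sub_pos.2 hst
  calc (t - s) * |(⨍ x in Set.Ico s t, u x) - A|
      = |∫ x in Set.Ico s t, (u x - A)| := by
        rw [integral_sub (hu.mono_set hsub) (integrableOn_const (by simp)),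
          ← sub_mul_setAverage_Ico hst u, setIntegral_Ico_const hst, ← mul_sub, abs_mul,
          abs_of_pos h0]
    _ ≤ ∫ x in Set.Ico s t, |u x - A| := abs_integral_le_integral_abs
    _ ≤ ∫ x in Set.Ico s' t', |u x - A| :=
        setIntegral_mono_set hi.abs (ae_of_all _ fun _ => abs_nonneg _) hsub.eventuallyLE

/-- The constant in the telescoping estimate `abs_average_sub_le`, chosen as the solution `C` of
`C = 2 + 2 ^ (-q) C`. -/
def telescopeConst (q : ℝ) : ℝ := 2 / (1 - 2 ^ (-q))

lemma two_rpow_neg_lt_one {q : ℝ} (hq : 0 < q) : (2 : ℝ) ^ (-q) < 1 :=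
  Real.rpow_lt_one_of_one_lt_of_neg (by norm_num) (by linarith)

lemma telescopeConst_pos {q : ℝ} (hq : 0 < q) : 0 < telescopeConst q :=
  div_pos (by norm_num) (by linarith [two_rpow_neg_lt_one hq])

lemma telescopeConst_eq {q : ℝ} (hq : 0 < q) :
    telescopeConst q = 2 + 2 ^ (-q) * telescopeConst q := by
  have := two_rpow_neg_lt_one hq
  unfold telescopeConst
  have h : (1 : ℝ) - 2 ^ (-q) ≠ 0 := by linarith
  field_simp
  ring

/-- One step of the telescoping: the averages over an interval and over a larger one of at most
twice its length. -/
lemma rpow_mul_abs_average_sub_le {q B : ℝ} (hq1 : q < 1) (hq : 0 < q) (hB : 0 ≤ B)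
    {s t s' t' : ℝ} (hst : s < t) (hs : s' ≤ s) (ht : t ≤ t') (h2 : t' - s' ≤ 2 * (t - s))
    (hu : IntegrableOn u (Set.Ico s' t'))
    (H : ∫ x in Set.Ico s' t', |u x - ⨍ y in Set.Ico s' t', u y| ≤ B * (t' - s') ^ (1 - q)) :
    (t - s) ^ q * |(⨍ x in Set.Ico s t, u x) - ⨍ x in Set.Ico s' t', u x| ≤ 2 * B := by
  have h0 : (0 : ℝ) < t - s := sub_pos.2 hst
  have h1 := (sub_mul_abs_average_sub_le (A := ⨍ x in Set.Ico s' t', u x) hst hs ht hu).trans H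
  have h3 : (t' - s') ^ (1 - q) ≤ 2 * (t - s) ^ (1 - q) := by
    calc (t' - s') ^ (1 - q) ≤ (2 * (t - s)) ^ (1 - q) :=
          Real.rpow_le_rpow (by linarith) h2 (by linarith)
      _ = 2 ^ (1 - q) * (t - s) ^ (1 - q) := Real.mul_rpow (by norm_num) h0.le
      _ ≤ 2 ^ (1 : ℝ) * (t - s) ^ (1 - q) := by
          gcongr
          · norm_num
          · linarith
      _ = 2 * (t - s) ^ (1 - q) := by rw [Real.rpow_one]
  have h4 : (0 : ℝ) < (t - s) ^ (1 - q) := Real.rpow_pos_of_pos h0 _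
  refine le_of_mul_le_mul_left ?_ h4
  calc (t - s) ^ (1 - q) *
        ((t - s) ^ q * |(⨍ x in Set.Ico s t, u x) - ⨍ x in Set.Ico s' t', u x|)
      = (t - s) * |(⨍ x in Set.Ico s t, u x) - ⨍ x in Set.Ico s' t', u x| := by
        rw [← mul_assoc, ← Real.rpow_add h0]
        simp
    _ ≤ B * (t' - s') ^ (1 - q) := h1
    _ ≤ B * (2 * (t - s) ^ (1 - q)) := by gcongr
    _ = (t - s) ^ (1 - q) * (2 * B) := by ring

/-- An interval of at most half the length of `[c, d]` can be doubled inside `[c, d]`. -/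
lemma exists_double_interval {s t : ℝ} (hs : c ≤ s) (ht : t ≤ d) (hst : s < t)
    (h2 : 2 * (t - s) ≤ d - c) :
    ∃ s' t', c ≤ s' ∧ s' ≤ s ∧ t ≤ t' ∧ t' ≤ d ∧ t' - s' = 2 * (t - s) := by
  rcases le_total c (2 * s - t) with h | h
  · exact ⟨2 * s - t, t, h, by linarith, le_rfl, ht, by ring⟩
  · exact ⟨c, c + 2 * (t - s), le_rfl, hs, by linarith, by linarith, by ring⟩

/-- Telescoping along doublings: if the oscillation over every subinterval `K` of `[c, d)` is at
most `B |K|^(1 - q)`, then the averages deviate from the full one by at most `C B |K|^(-q)`. -/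
lemma abs_average_sub_le {q B : ℝ} (hq1 : q < 1) (hq : 0 < q) (hB : 0 ≤ B)
    (hu : IntegrableOn u (Set.Ico c d))
    (H : ∀ s t, c ≤ s → s < t → t ≤ d →
      ∫ x in Set.Ico s t, |u x - ⨍ y in Set.Ico s t, u y| ≤ B * (t - s) ^ (1 - q)) (m : ℕ) :
    ∀ s t, c ≤ s → s < t → t ≤ d → d - c ≤ 2 ^ m * (t - s) →
      (t - s) ^ q * |(⨍ x in Set.Ico s t, u x) - ⨍ x in Set.Ico c d, u x|
        ≤ telescopeConst q * B := by
  have hC := telescopeConst_pos hq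
  have hC' := telescopeConst_eq hq
  have hp2 : (0 : ℝ) < 2 ^ (-q) := Real.rpow_pos_of_pos (by norm_num) _
  have hC2 : 2 ≤ telescopeConst q := by nlinarith
  induction m with
  | zero =>
    intro s t hs hst ht hm
    refine (rpow_mul_abs_average_sub_le hq1 hq hB hst hs ht (by linarith) hu
      (H c d le_rfl (by linarith) le_rfl)).trans ?_
    gcongr
  | succ m ih =>
    intro s t hs hst ht hm
    rcases le_total (d - c) (2 * (t - s)) with h | h
    · refine (rpow_mul_abs_average_sub_le hq1 hq hB hst hs ht h hu
        (H c d le_rfl (by linarith) le_rfl)).trans ?_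
      gcongr
    · obtain ⟨s', t', hs1, hs2, ht1, ht2, hd⟩ := exists_double_interval hs ht hst h
      have h0 : (0 : ℝ) < t - s := sub_pos.2 hst
      have h1 := rpow_mul_abs_average_sub_le hq1 hq hB hst hs2 ht1 hd.le
        (hu.mono_set (Set.Ico_subset_Ico hs1 ht2)) (H s' t' hs1 (by linarith) ht2)
      have h2 := ih s' t' hs1 (by linarith) ht2 (by rw [hd, ← mul_assoc, ← pow_succ]; exact hm)
      rw [hd, Real.mul_rpow (by norm_num) h0.le] at h2
      have h3 : (t - s) ^ q * |(⨍ x in Set.Ico s' t', u x) - ⨍ x in Set.Ico c d, u x|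
          ≤ 2 ^ (-q) * (telescopeConst q * B) := by
        refine le_trans (le_of_eq ?_) (mul_le_mul_of_nonneg_left h2 hp2.le)
        rw [← mul_assoc, ← mul_assoc, ← Real.rpow_add (by norm_num)]
        simp
      calc (t - s) ^ q * |(⨍ x in Set.Ico s t, u x) - ⨍ x in Set.Ico c d, u x|
          ≤ (t - s) ^ q * (|(⨍ x in Set.Ico s t, u x) - ⨍ x in Set.Ico s' t', u x|
            + |(⨍ x in Set.Ico s' t', u x) - ⨍ x in Set.Ico c d, u x|) := by
            gcongr
            exact abs_sub_le _ _ _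
        _ ≤ 2 * B + 2 ^ (-q) * (telescopeConst q * B) := by
            rw [mul_add]
            exact add_le_add h1 h3
        _ = (2 + 2 ^ (-q) * telescopeConst q) * B := by ring
        _ = telescopeConst q * B := by rw [← hC']

/-- Campanato bounds imply Morrey bounds, after subtraction of the average. -/
lemma setIntegral_abs_sub_average_le {q B : ℝ} (hq1 : q < 1) (hq : 0 < q) (hB : 0 ≤ B)
    (hu : IntegrableOn u (Set.Ico c d))
    (H : ∀ s t, c ≤ s → s < t → t ≤ d →
      ∫ x in Set.Ico s t, |u x - ⨍ y in Set.Ico s t, u y| ≤ B * (t - s) ^ (1 - q))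
    {s t : ℝ} (hs : c ≤ s) (hst : s < t) (ht : t ≤ d) :
    ∫ x in Set.Ico s t, |u x - ⨍ y in Set.Ico c d, u y|
      ≤ (1 + telescopeConst q) * B * (t - s) ^ (1 - q) := by
  have h0 : (0 : ℝ) < t - s := sub_pos.2 hst
  obtain ⟨m, hm⟩ := pow_unbounded_of_one_lt ((d - c) / (t - s)) (one_lt_two (α := ℝ))
  have h1 := abs_average_sub_le hq1 hq hB hu H m s t hs hst ht ((div_le_iff₀ h0).1 hm.le)
  have hus : IntegrableOn u (Set.Ico s t) := hu.mono_set (Set.Ico_subset_Ico hs ht)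
  have hk : ∀ k : ℝ, IntegrableOn (fun _ => k) (Set.Ico s t) := fun k =>
    integrableOn_const (by simp)
  set A := ⨍ x in Set.Ico c d, u x
  set A' := ⨍ x in Set.Ico s t, u x
  have hi : IntegrableOn (fun x => |u x - A'|) (Set.Ico s t) := (Integrable.sub hus (hk _)).abs
  have h2 : (t - s) * |A' - A| ≤ telescopeConst q * B * (t - s) ^ (1 - q) := by
    have h4 : (0 : ℝ) < (t - s) ^ (1 - q) := Real.rpow_pos_of_pos h0 _
    calc (t - s) * |A' - A| = ((t - s) ^ q * |A' - A|) * (t - s) ^ (1 - q) := by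
          rw [mul_right_comm, ← Real.rpow_add h0]
          simp
      _ ≤ _ := by gcongr
  calc ∫ x in Set.Ico s t, |u x - A|
      ≤ ∫ x in Set.Ico s t, (|u x - A'| + |A' - A|) :=
        integral_mono (Integrable.sub hus (hk _)).abs
          (hi.add (hk _)) fun x => abs_sub_le _ _ _
    _ = (∫ x in Set.Ico s t, |u x - A'|) + (t - s) * |A' - A| := by
        rw [integral_add hi (hk _), setIntegral_Ico_const hst]
    _ ≤ B * (t - s) ^ (1 - q) + telescopeConst q * B * (t - s) ^ (1 - q) :=
        add_le_add (H s t hs hst ht) h2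
    _ = _ := by ring

end Campanato

/-- The largest contribution `|K| (⨍_K |u - u_K|)ᵖ` of a subinterval `K` of `[c, d)`. -/
def maxIntervalEnergy (p : ℝ) (u : ℝ → ℝ) (c d : ℝ) : ℝ≥0∞ :=
  ⨆ K : {z : ℝ × ℝ // c ≤ z.1 ∧ z.1 < z.2 ∧ z.2 ≤ d}, intervalEnergy p u K.1.1 K.1.2

/-- The constant in the Morrey bound `lintegral_sub_average_rpow_le`. -/
def morreyConst (p : ℝ) : ℝ≥0∞ := ENNReal.ofReal ((1 + telescopeConst (1 / p)) ^ p)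

lemma intervalOsc_nonneg (u : ℝ → ℝ) (s t : ℝ) : 0 ≤ intervalOsc u s t := by
  unfold intervalOsc
  rw [setAverage_eq]
  exact smul_nonneg (by positivity) (integral_nonneg fun _ => abs_nonneg _)

lemma setIntegral_abs_sub_average_le_of_intervalEnergy_le {p D : ℝ} (hp : 1 < p) (hD : 0 ≤ D)
    {u : ℝ → ℝ} {s t : ℝ} (hst : s < t) (h : intervalEnergy p u s t ≤ ENNReal.ofReal D) :
    ∫ x in Set.Ico s t, |u x - ⨍ y in Set.Ico s t, u y|
      ≤ D ^ (1 / p) * (t - s) ^ (1 - 1 / p) := by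
  have h0 : (0 : ℝ) < t - s := sub_pos.2 hst
  have hp0 : 0 < p := by linarith
  have ho := intervalOsc_nonneg u s t
  rw [intervalEnergy, ENNReal.ofReal_rpow_of_nonneg ho hp0.le, ← ENNReal.ofReal_mul h0.le,
    ENNReal.ofReal_le_ofReal_iff hD] at h
  have h1 : ((t - s) * intervalOsc u s t ^ p) ^ (1 / p) ≤ D ^ (1 / p) :=
    Real.rpow_le_rpow (by positivity) h (by positivity)
  rw [Real.mul_rpow h0.le (by positivity), ← Real.rpow_mul ho, mul_one_div_cancel hp0.ne',
    Real.rpow_one] at h1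
  rw [← sub_mul_setAverage_Ico hst]
  change (t - s) * intervalOsc u s t ≤ _
  calc (t - s) * intervalOsc u s t
      = ((t - s) ^ (1 / p) * intervalOsc u s t) * (t - s) ^ (1 - 1 / p) := by
        rw [mul_right_comm, ← Real.rpow_add h0]
        simp
    _ ≤ _ := by gcongr

/-- The Morrey bound `|J|^(1 - p) (∫_J |u - u_I|)ᵖ ≤ C sup_K |K| (⨍_K |u - u_K|)ᵖ` for
`J ⊆ I = [c, d)`, the supremum being over the subintervals `K` of `I`. -/
lemma lintegral_sub_average_rpow_le {p : ℝ} (hp : 1 < p) {u : ℝ → ℝ} {c d s t : ℝ}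
    (hu : IntegrableOn u (Set.Ico c d)) (hs : c ≤ s) (hst : s < t) (ht : t ≤ d) :
    (∫⁻ x in Set.Ico s t, ‖u x - ⨍ y in Set.Ico c d, u y‖ₑ) ^ p
      ≤ morreyConst p * maxIntervalEnergy p u c d * ENNReal.ofReal (t - s) ^ (p - 1) := by
  have h0 : (0 : ℝ) < t - s := sub_pos.2 hst
  have hp0 : 0 < p := by linarith
  have hC := telescopeConst_pos (one_div_pos.2 hp0)
  have hpow : ENNReal.ofReal (t - s) ^ (p - 1) = ENNReal.ofReal ((t - s) ^ (p - 1)) :=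
    ENNReal.ofReal_rpow_of_pos h0
  rcases eq_or_ne (maxIntervalEnergy p u c d) ⊤ with htop | htop
  · have h1 : morreyConst p ≠ 0 := by
      have : (0 : ℝ) < (1 + telescopeConst (1 / p)) ^ p := by positivity
      simpa [morreyConst] using this
    have h2 : ENNReal.ofReal ((t - s) ^ (p - 1)) ≠ 0 := by
      have : (0 : ℝ) < (t - s) ^ (p - 1) := by positivity
      simpa using this
    rw [htop, ENNReal.mul_top h1, hpow, ENNReal.top_mul h2]
    exact le_top
  set D := (maxIntervalEnergy p u c d).toReal with hDdef
  have hD : 0 ≤ D := ENNReal.toReal_nonneg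
  have hDof : ENNReal.ofReal D = maxIntervalEnergy p u c d := ENNReal.ofReal_toReal htop
  have hus : IntegrableOn u (Set.Ico s t) := hu.mono_set (Set.Ico_subset_Ico hs ht)
  have key := setIntegral_abs_sub_average_le (q := 1 / p) (B := D ^ (1 / p))
    ((div_lt_one hp0).2 hp) (by positivity) (by positivity) hu (fun s' t' hs' hst' ht' =>
      setIntegral_abs_sub_average_le_of_intervalEnergy_le hp hD hst' (by
        rw [hDof]
        exact le_iSup (fun K : {z : ℝ × ℝ // c ≤ z.1 ∧ z.1 < z.2 ∧ z.2 ≤ d} =>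
          intervalEnergy p u K.1.1 K.1.2) ⟨(s', t'), hs', hst', ht'⟩)) hs hst ht
  have hint : ∫⁻ x in Set.Ico s t, ‖u x - ⨍ y in Set.Ico c d, u y‖ₑ =
      ENNReal.ofReal (∫ x in Set.Ico s t, |u x - ⨍ y in Set.Ico c d, u y|) :=
    (ofReal_integral_norm_eq_lintegral_enorm
      (Integrable.sub hus (integrableOn_const (by simp)))).symm
  rw [hint, ENNReal.ofReal_rpow_of_nonneg (integral_nonneg fun _ => abs_nonneg _) hp0.le, hpow,
    ← hDof, morreyConst, ← ENNReal.ofReal_mul (by positivity), ← ENNReal.ofReal_mul (by positivity)]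
  refine ENNReal.ofReal_le_ofReal
    ((Real.rpow_le_rpow (integral_nonneg fun _ => abs_nonneg _) key hp0.le).trans_eq ?_)
  rw [Real.mul_rpow (by positivity) (by positivity), Real.mul_rpow (by positivity) (by positivity),
    ← Real.rpow_mul hD, one_div_mul_cancel hp0.ne', Real.rpow_one, ← Real.rpow_mul h0.le]
  congr 2
  field_simp

/-! ### The modulus of vanishing -/

/-- The supremum of the sums `jnSum p g S` over the families `S` of cubes in `X` of side at
most `a`, whose limit for `a → 0` enters the definition of `VJN_p`. -/
def jnModulus {n : ℕ} (p : ℝ) (X : Set (Fin n → ℝ)) (g : (Fin n → ℝ) → ℝ) (a : ℝ) : ℝ≥0∞ :=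
  ⨆ (S : Set (Cube n)) (_ : IsDisjointFamily X S) (_ : ∀ Q ∈ S, Q.side ≤ a), jnSum p g S

lemma jnSum_le_jnModulus {n : ℕ} {p : ℝ} {X : Set (Fin n → ℝ)} {g : (Fin n → ℝ) → ℝ} {a : ℝ}
    {S : Set (Cube n)} (hS : IsDisjointFamily X S) (ha : ∀ Q ∈ S, Q.side ≤ a) :
    jnSum p g S ≤ jnModulus p X g a :=
  le_iSup_of_le S (le_iSup₂_of_le hS ha le_rfl)

/-- The closed interval `[0, L]` as a subset of `ℝ¹`. -/
def closedInterval (L : ℝ) : Set (Fin 1 → ℝ) := {x | ∀ i, 0 ≤ x i ∧ x i ≤ L}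

/-- A countable family of disjoint intervals in `[0, L)`, seen as a family of cubes in `ℝ¹`. -/
lemma tsum_intervalEnergy_le_jnModulus {ι : Type*} [Countable ι] {p L a : ℝ} {f : ℝ → ℝ}
    (hf : IntegrableOn f (Set.Icc 0 L)) (s l : ι → ℝ) (hl : ∀ i, 0 < l i) (hla : ∀ i, l i ≤ a)
    (hs : ∀ i, 0 ≤ s i) (hsl : ∀ i, s i + l i ≤ L)
    (hd : Pairwise (Function.onFun Disjoint fun i => Set.Ico (s i) (s i + l i))) :
    ∑' i, intervalEnergy p f (s i) (s i + l i)
      ≤ jnModulus p (closedInterval L) (fun x => f (x 0)) a := by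
  set Q : ι → Cube 1 := fun i => ⟨fun _ => s i, l i, hl i⟩ with hQ
  have hQd : Pairwise (Function.onFun Disjoint fun i => (Q i).toSet) := by
    intro i j hij
    refine Set.disjoint_left.2 fun x hxi hxj => ?_
    exact Set.disjoint_left.1 (hd hij) (hxi 0 trivial) (hxj 0 trivial)
  have hQX : ∀ i, (Q i).toSet ⊆ closedInterval L := by
    intro i x hx k
    have := hx k trivial
    simp only [hQ, Set.mem_Ico] at this
    exact ⟨(hs i).trans this.1, (this.2.trans_le (hsl i)).le⟩
  have hE : ∀ i, intervalEnergy p f (s i) (s i + l i) = cubeEnergy p (fun x => f (x 0)) (Q i) := by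
    intro i
    rw [cubeEnergy_comp_zero]
    · simp [hQ]
    · refine hf.mono_set fun x hx => ?_
      simp only [hQ, Set.mem_Ico] at hx
      exact ⟨(hs i).trans hx.1, (hx.2.trans_le (hsl i)).le⟩
  simp_rw [hE]
  rw [tsum_cubeEnergy_eq_jnSum p _ Q hQd]
  refine jnSum_le_jnModulus (isDisjointFamily_range Q hQd hQX) ?_
  rintro _ ⟨i, rfl⟩
  exact hla i

/-- Choosing one subinterval in each cell of a partition of `[0, L)` gives a disjoint family. -/
lemma sum_maxIntervalEnergy_le_jnModulus {p L a : ℝ} {f : ℝ → ℝ}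
    (hf : IntegrableOn f (Set.Icc 0 L)) {N : ℕ} {x : ℕ → ℝ} (hx : StrictMono x) (h0 : x 0 = 0)
    (hN : x N = L) (ha : ∀ j, x (j + 1) - x j ≤ a) :
    ∑ j ∈ Finset.range N, maxIntervalEnergy p f (x j) (x (j + 1))
      ≤ jnModulus p (closedInterval L) (fun y => f (y 0)) a := by
  classical
  let I : ℕ → Type := fun j => {z : ℝ × ℝ // x j ≤ z.1 ∧ z.1 < z.2 ∧ z.2 ≤ x (j + 1)}
  have hI : ∀ j, Nonempty (I j) := fun j =>
    ⟨⟨(x j, x (j + 1)), le_rfl, hx (Nat.lt_succ_self j), le_rfl⟩⟩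
  have h1 : ∀ j, maxIntervalEnergy p f (x j) (x (j + 1)) =
      ⨆ K : (∀ j, I j), intervalEnergy p f (K j).1.1 (K j).1.2 := by
    intro j
    have hsurj : Function.Surjective (fun K : (∀ j, I j) => K j) := Function.surjective_eval j
    exact (hsurj.iSup_comp (g := fun z : I j => intervalEnergy p f z.1.1 z.1.2)).symm
  simp_rw [h1]
  rw [ENNReal.finsetSum_iSup]
  · refine iSup_le fun K => ?_
    rw [← Finset.sum_coe_sort, ← tsum_fintype (L := .unconditional _)]
    have := tsum_intervalEnergy_le_jnModulus (p := p) (a := a) hf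
      (fun j : Finset.range N => (K j).1.1) (fun j => (K j).1.2 - (K j).1.1)
      (fun j => sub_pos.2 (K j).2.2.1)
      (fun j => by linarith [(K j).2.1, (K j).2.2.2, ha j])
      (fun j => by
        have := hx.monotone (Nat.zero_le (j : ℕ))
        linarith [(K j).2.1])
      (fun j => by
        have := hx.monotone (Finset.mem_range.1 j.2 : (j : ℕ) + 1 ≤ N)
        linarith [(K j).2.2.2]) (by
        intro i j hij
        have hne : (i : ℕ) ≠ j := fun h => hij (Subtype.ext h)
        refine Set.disjoint_left.2 fun y hyi hyj => ?_
        simp only [Set.mem_Ico, add_sub_cancel] at hyi hyj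
        rcases lt_or_gt_of_ne hne with h | h
        · have := hx.monotone (h : (i : ℕ) + 1 ≤ j)
          linarith [(K i).2.2.2, (K j).2.1]
        · have := hx.monotone (h : (j : ℕ) + 1 ≤ i)
          linarith [(K j).2.2.2, (K i).2.1])
    simpa only [add_sub_cancel] using this
  · intro K K'
    refine ⟨fun j => if intervalEnergy p f (K j).1.1 (K j).1.2 ≤
      intervalEnergy p f (K' j).1.1 (K' j).1.2 then K' j else K j, fun j => ?_⟩
    dsimp only
    split_ifs with h
    · exact ⟨h, le_rfl⟩
    · exact ⟨le_rfl, (not_le.1 h).le⟩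

/-! ### Surface measures of slabs -/

section Faces

variable {n : ℕ}

/-- The `(n - 1)`-dimensional measure on the part of the hyperplane `x i = y` whose other
coordinates lie in `[0, L)`, as a product measure with one Dirac factor. -/
def faceMeasure (L : ℝ) (i : Fin n) (y : ℝ) : Measure (Fin n → ℝ) :=
  Measure.pi fun k => if k = i then Measure.dirac y else volume.restrict (Set.Ico 0 L)

lemma sigmaFinite_faceFactor (L : ℝ) (i : Fin n) (y : ℝ) (k : Fin n) :
    SigmaFinite (if k = i then Measure.dirac y else volume.restrict (Set.Ico 0 L)) := by
  split_ifs <;> infer_instance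

lemma faceMeasure_pi (L : ℝ) (i : Fin n) {y : ℝ} {t : Fin n → Set ℝ} (hy : y ∈ t i)
    (ht : ∀ k, MeasurableSet (t k)) :
    faceMeasure L i y (Set.univ.pi t) =
      ∏ k ∈ Finset.univ.erase i, volume (t k ∩ Set.Ico 0 L) := by
  have := sigmaFinite_faceFactor L i y
  rw [faceMeasure, Measure.pi_pi, ← Finset.mul_prod_erase _ _ (Finset.mem_univ i)]
  simp only [if_true, Measure.dirac_apply' _ (ht i), Set.indicator_of_mem hy, Pi.one_apply, one_mul]
  refine Finset.prod_congr rfl fun k hk => ?_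
  rw [if_neg (Finset.ne_of_mem_erase hk), Measure.restrict_apply (ht k)]

lemma faceMeasure_univ (L : ℝ) (i : Fin n) (y : ℝ) :
    faceMeasure L i y Set.univ = ENNReal.ofReal L ^ (n - 1) := by
  rw [← Set.pi_univ Set.univ, faceMeasure_pi L i (Set.mem_univ y) fun _ => MeasurableSet.univ]
  simp [Finset.card_erase_of_mem]

lemma faceMeasure_toSet (L : ℝ) (Q : Cube n) (i : Fin n) {y : ℝ}
    (hy : y ∈ Set.Ico (Q.corner i) (Q.corner i + Q.side)) :
    faceMeasure L i y Q.toSet = ∏ k ∈ Finset.univ.erase i,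
      volume (Set.Ico (Q.corner k) (Q.corner k + Q.side) ∩ Set.Ico 0 L) :=
  faceMeasure_pi L i hy fun _ => measurableSet_Ico

variable [NeZero n]

/-- The slab `[c, d) × [0, L)^(n - 1)`. -/
def slab (n : ℕ) [NeZero n] (L c d : ℝ) : Set (Fin n → ℝ) :=
  {x | x 0 ∈ Set.Ico c d ∧ ∀ i, i ≠ 0 → x i ∈ Set.Ico 0 L}

/-- The surface measure on the boundary of the slab `[c, d) × [0, L)^(n - 1)`, each face being
extended to the full range `[0, L)` of the first coordinate. -/
def slabBoundary (n : ℕ) [NeZero n] (L c d : ℝ) : Measure (Fin n → ℝ) :=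
  (faceMeasure L 0 c + faceMeasure L 0 d) +
    ∑ i ∈ Finset.univ.erase 0, (faceMeasure L i 0 + faceMeasure L i L)

lemma slabBoundary_univ (L c d : ℝ) :
    slabBoundary n L c d Set.univ = 2 * n * ENNReal.ofReal L ^ (n - 1) := by
  have hn : ((n - 1 : ℕ) : ℝ≥0∞) + 1 = n := by
    exact_mod_cast Nat.sub_add_cancel (Nat.one_le_iff_ne_zero.2 (NeZero.ne n))
  simp only [slabBoundary, Measure.add_apply, Measure.finsetSum_apply, faceMeasure_univ,
    Finset.sum_const, Finset.card_erase_of_mem (Finset.mem_univ _), Finset.card_univ,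
    Fintype.card_fin, nsmul_eq_mul]
  rw [← hn]
  ring

/-- The measure of the projection of `Q ∩ [0, L)ⁿ` to the coordinates other than the first. -/
def baseMeasure (L : ℝ) (Q : Cube n) : ℝ≥0∞ :=
  ∏ k ∈ Finset.univ.erase 0,
    volume (Set.Ico (Q.corner k) (Q.corner k + Q.side) ∩ Set.Ico 0 L)

lemma left_mem_or_right_mem {α β c d : ℝ} (hm : (Set.Ico α β ∩ Set.Ico c d).Nonempty)
    (hn : ¬ Set.Ico α β ⊆ Set.Ico c d) : c ∈ Set.Ico α β ∨ d ∈ Set.Ico α β := by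
  obtain ⟨y, ⟨hy1, hy2⟩, hy3, hy4⟩ := hm
  obtain ⟨z, ⟨hz1, hz2⟩, hz⟩ := Set.not_subset.1 hn
  rcases lt_or_ge z c with h | h
  · exact Or.inl ⟨by linarith, by linarith⟩
  · have : d ≤ z := by
      by_contra! h'
      exact hz ⟨h, h'⟩
    exact Or.inr ⟨by linarith, by linarith⟩

/-- A cube that meets a slab without being contained in it meets the boundary of the slab in a
set whose measure is at least that of the base of the cube. If the cube crosses one of the two faces
orthogonal to the first axis, this face will do. Otherwise the full side of the cube in direction of
the first axis lies in `[c, d)`, and it replaces the shorter side in the direction orthogonal to the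
face that is crossed. -/
lemma baseMeasure_le_slabBoundary {L c d : ℝ} (hc : 0 ≤ c) (hd : d ≤ L) {Q : Cube n}
    (h0 : (Set.Ico (Q.corner 0) (Q.corner 0 + Q.side) ∩ Set.Ico c d).Nonempty)
    (hk : ∀ k, k ≠ 0 → (Set.Ico (Q.corner k) (Q.corner k + Q.side) ∩ Set.Ico 0 L).Nonempty)
    (hQ : ¬ Q.toSet ⊆ slab n L c d) :
    baseMeasure L Q ≤ slabBoundary n L c d Q.toSet := by
  rw [slabBoundary, Measure.add_apply, Measure.add_apply]
  by_cases hJ : Set.Ico (Q.corner 0) (Q.corner 0 + Q.side) ⊆ Set.Ico c d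
  · have : ∃ i, i ≠ 0 ∧ ¬ Set.Ico (Q.corner i) (Q.corner i + Q.side) ⊆ Set.Ico 0 L := by
      by_contra! H
      exact hQ fun x hx => ⟨hJ (hx 0 trivial), fun i hi => H i hi (hx i trivial)⟩
    obtain ⟨i, hi, hni⟩ := this
    refine le_trans ?_ le_add_self
    rw [Measure.finsetSum_apply]
    have hi' : i ∈ Finset.univ.erase (0 : Fin n) := Finset.mem_erase.2 ⟨hi, Finset.mem_univ _⟩
    refine le_trans ?_ (Finset.single_le_sum
      (f := fun i => (faceMeasure L i 0 + faceMeasure L i L) Q.toSet)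
      (fun _ _ => zero_le) hi')
    have hle : baseMeasure L Q ≤ ∏ k ∈ Finset.univ.erase i,
        volume (Set.Ico (Q.corner k) (Q.corner k + Q.side) ∩ Set.Ico 0 L) := by
      have h0i : (0 : Fin n) ∈ Finset.univ.erase i :=
        Finset.mem_erase.2 ⟨hi.symm, Finset.mem_univ _⟩
      rw [baseMeasure, ← Finset.mul_prod_erase _ _ hi', ← Finset.mul_prod_erase _ _ h0i,
        Finset.erase_right_comm]
      gcongr ?_ * _
      rw [Set.inter_eq_left.2 (hJ.trans (Set.Ico_subset_Ico hc hd))]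
      refine (measure_mono Set.inter_subset_left).trans ?_
      simp
    rw [Measure.add_apply]
    rcases left_mem_or_right_mem (hk i hi) hni with h | h
    · rw [faceMeasure_toSet L Q i h]
      exact hle.trans le_self_add
    · rw [faceMeasure_toSet L Q i h]
      exact hle.trans le_add_self
  · refine le_trans ?_ le_self_add
    rcases left_mem_or_right_mem h0 hJ with h | h
    · rw [faceMeasure_toSet L Q 0 h]
      exact le_self_add
    · rw [faceMeasure_toSet L Q 0 h]
      exact le_add_self

end Faces

/-! ### Cubes that cross the boundary of a slab -/

lemma sum_rpow_le_sum_mul_sum_rpow {ι : Type*} {p : ℝ} (hp : 1 < p) (s : Finset ι)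
    {X M μ : ι → ℝ≥0∞} (h : ∀ j ∈ s, X j ^ p ≤ M j * μ j ^ (p - 1)) :
    (∑ j ∈ s, X j) ^ p ≤ (∑ j ∈ s, M j) * (∑ j ∈ s, μ j) ^ (p - 1) := by
  have hp0 : 0 < p := by linarith
  have hpq := Real.HolderConjugate.conjExponent hp
  have hq : 1 / p.conjExponent * p = p - 1 := by
    rw [Real.conjExponent]
    field_simp
  have hX : ∀ j ∈ s, X j ≤ M j ^ (1 / p) * μ j ^ (1 / p.conjExponent) := by
    intro j hj
    have := ENNReal.rpow_le_rpow (h j hj) (by positivity : 0 ≤ 1 / p)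
    rw [← ENNReal.rpow_mul, mul_one_div_cancel hp0.ne', ENNReal.rpow_one,
      ENNReal.mul_rpow_of_nonneg _ _ (by positivity), ← ENNReal.rpow_mul] at this
    convert this using 3
    rw [← hq]
    field_simp
  have H := (Finset.sum_le_sum hX).trans (ENNReal.inner_le_Lp_mul_Lq s _ _ hpq)
  simp_rw [← ENNReal.rpow_mul] at H
  rw [one_div_mul_cancel hp0.ne', one_div_mul_cancel hpq.symm.ne_zero] at H
  simp_rw [ENNReal.rpow_one] at H
  refine (ENNReal.rpow_le_rpow H hp0.le).trans_eq ?_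
  rw [ENNReal.mul_rpow_of_nonneg _ _ hp0.le, ← ENNReal.rpow_mul, ← ENNReal.rpow_mul, hq,
    one_div_mul_cancel hp0.ne', ENNReal.rpow_one]

/-- Scaling computation: for a cube of side `l` with `D = l^(n - 1)`, whose base meets
`[0, L)^(n - 1)` in measure `R`. -/
lemma mul_inv_mul_rpow_le {p : ℝ} (hp : 1 < p) {l D R Y M : ℝ≥0∞} (hl0 : l ≠ 0) (hl : l ≠ ⊤)
    (hD0 : D ≠ 0) (hD : D ≠ ⊤) (hR : R ≤ D) (hY : Y ^ p ≤ M * l ^ (p - 1)) :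
    (l * D) * ((l * D)⁻¹ * (R * Y)) ^ p ≤ R * M := by
  have hp0 : 0 ≤ p := by linarith
  have h1 : (D⁻¹ * R) ^ p ≤ D⁻¹ * R := by
    have hle : D⁻¹ * R ≤ 1 := by
      calc D⁻¹ * R ≤ D⁻¹ * D := by gcongr
        _ = 1 := ENNReal.inv_mul_cancel hD0 hD
    calc (D⁻¹ * R) ^ p ≤ (D⁻¹ * R) ^ (1 : ℝ) :=
          ENNReal.rpow_le_rpow_of_exponent_ge hle hp.le
      _ = D⁻¹ * R := ENNReal.rpow_one _
  have h2 : (l * D)⁻¹ * (R * Y) = (D⁻¹ * R) * (l⁻¹ * Y) := by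
    rw [ENNReal.mul_inv (Or.inl hl0) (Or.inl hl)]
    ring
  have h3 : l * ((l⁻¹) ^ p * l ^ (p - 1)) = 1 := by
    rw [ENNReal.inv_rpow, ← ENNReal.rpow_neg, ← ENNReal.rpow_add _ _ hl0 hl,
      show -p + (p - 1) = -1 by ring, ENNReal.rpow_neg_one, ENNReal.mul_inv_cancel hl0 hl]
  calc (l * D) * ((l * D)⁻¹ * (R * Y)) ^ p
      = (l * D) * ((D⁻¹ * R) ^ p * ((l⁻¹) ^ p * Y ^ p)) := by
        rw [h2, ENNReal.mul_rpow_of_nonneg (D⁻¹ * R) _ hp0, ENNReal.mul_rpow_of_nonneg l⁻¹ _ hp0]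
    _ ≤ (l * D) * ((D⁻¹ * R) * ((l⁻¹) ^ p * (M * l ^ (p - 1)))) := by gcongr
    _ = (D * D⁻¹) * (l * ((l⁻¹) ^ p * l ^ (p - 1))) * (R * M) := by ring
    _ = R * M := by rw [h3, ENNReal.mul_inv_cancel hD0 hD]; ring

section Crossing

variable {n : ℕ} [NeZero n]

/-- The function `v (x 0)` on `[0, L)ⁿ`, extended by zero. -/
def columnExt (n : ℕ) [NeZero n] (L : ℝ) (v : ℝ → ℝ) : (Fin n → ℝ) → ℝ :=
  (Set.univ.pi fun _ => Set.Ico 0 L).indicator fun x => v (x 0)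

lemma setLIntegral_columnExt {L : ℝ} {v : ℝ → ℝ} (hv : AEStronglyMeasurable v) (Q : Cube n) :
    ∫⁻ x in Q.toSet, ‖columnExt n L v x‖ₑ = baseMeasure L Q *
      ∫⁻ x in Set.Ico (Q.corner 0) (Q.corner 0 + Q.side) ∩ Set.Ico 0 L, ‖v x‖ₑ := by
  have hm : MeasurableSet (Set.univ.pi fun _ : Fin n => Set.Ico 0 L) :=
    MeasurableSet.univ_pi fun _ => measurableSet_Ico
  have h1 : ∀ x, ‖columnExt n L v x‖ₑ =
      (Set.univ.pi fun _ : Fin n => Set.Ico 0 L).indicator (fun x => ‖v (x 0)‖ₑ) x := by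
    intro x
    rw [columnExt, enorm_indicator_eq_indicator_enorm]
  simp_rw [h1]
  rw [setLIntegral_indicator hm, Set.inter_comm, Cube.toSet, ← Set.pi_inter_distrib]
  exact lintegral_pi_comp_zero
    (fun k => Set.Ico (Q.corner k) (Q.corner k + Q.side) ∩ Set.Ico 0 L) hv.enorm.restrict

lemma Ico_eq_biUnion_Ico {x : ℕ → ℝ} (hx : Monotone x) (N : ℕ) :
    Set.Ico (x 0) (x N) = ⋃ j ∈ Finset.range N, Set.Ico (x j) (x (j + 1)) := by
  induction N with
  | zero => simp
  | succ N ih =>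
    rw [Finset.range_add_one, Finset.set_biUnion_insert, ← ih, Set.union_comm,
      Set.Ico_union_Ico_eq_Ico (hx (Nat.zero_le _)) (hx (Nat.le_succ _))]

/-- Cubes that are not contained in one of the slabs: the Morrey bounds `M j` for `v` on the
cells of the partition control `|Q| (⨍_Q |v|)ᵖ` by the boundary measures of the slabs. -/
lemma volume_mul_average_columnExt_rpow_le {p L : ℝ} (hp : 1 < p) {v : ℝ → ℝ}
    (hv : AEStronglyMeasurable v) {N : ℕ} {x : ℕ → ℝ} (hx : StrictMono x) (h0 : x 0 = 0)
    (hN : x N = L) {M : ℕ → ℝ≥0∞}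
    (hM : ∀ j < N, ∀ s t, x j ≤ s → s < t → t ≤ x (j + 1) →
      (∫⁻ y in Set.Ico s t, ‖v y‖ₑ) ^ p ≤ M j * ENNReal.ofReal (t - s) ^ (p - 1))
    {Q : Cube n} (hQ : ∀ j < N, ¬ Q.toSet ⊆ slab n L (x j) (x (j + 1))) :
    volume Q.toSet * ((volume Q.toSet)⁻¹ * ∫⁻ y in Q.toSet, ‖columnExt n L v y‖ₑ) ^ p
      ≤ ∑ j ∈ Finset.range N, M j * slabBoundary n L (x j) (x (j + 1)) Q.toSet := by
  classical
  have hp0 : 0 < p := by linarith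
  set J := Set.Ico (Q.corner 0) (Q.corner 0 + Q.side) with hJ
  set I : ℕ → Set ℝ := fun j => Set.Ico (x j) (x (j + 1)) with hI
  set s := (Finset.range N).filter fun j => (J ∩ I j).Nonempty with hs
  have hd : Pairwise (Function.onFun Disjoint fun j => J ∩ I j) := fun i j hij =>
    (hx.monotone.pairwise_disjoint_on_Ico_succ hij).mono Set.inter_subset_right
      Set.inter_subset_right
  have hmeas : ∀ j, MeasurableSet (J ∩ I j) := fun j => measurableSet_Ico.inter measurableSet_Ico
  rw [setLIntegral_columnExt hv]
  set Y := ∫⁻ y in J ∩ Set.Ico 0 L, ‖v y‖ₑ with hY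
  set R := baseMeasure L Q with hR
  set l := ENNReal.ofReal Q.side with hl
  have hYs : Y = ∑ j ∈ s, ∫⁻ y in J ∩ I j, ‖v y‖ₑ := by
    rw [hY, ← h0, ← hN, Ico_eq_biUnion_Ico hx.monotone, Set.inter_iUnion₂,
      lintegral_biUnion_finset (fun i _ j _ hij => hd hij) (fun j _ => hmeas j), hs,
      Finset.sum_filter]
    refine Finset.sum_congr rfl fun j _ => ?_
    split_ifs with h
    · rfl
    · change ∫⁻ y in J ∩ I j, ‖v y‖ₑ = 0
      rw [Set.not_nonempty_iff_eq_empty.1 h, Measure.restrict_empty, lintegral_zero_measure]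
  have hYp : Y ^ p ≤ (∑ j ∈ s, M j) * l ^ (p - 1) := by
    have h1 := sum_rpow_le_sum_mul_sum_rpow hp s (X := fun j => ∫⁻ y in J ∩ I j, ‖v y‖ₑ) (M := M)
      (μ := fun j => volume (J ∩ I j)) (fun j hj => by
        obtain ⟨hjN, hne⟩ := Finset.mem_filter.1 hj
        simp only [hJ, hI, Set.Ico_inter_Ico, Set.nonempty_Ico] at hne ⊢
        rw [Real.volume_Ico]
        exact hM j (Finset.mem_range.1 hjN) _ _ le_sup_right hne inf_le_right)
    rw [hYs]
    refine h1.trans ?_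
    gcongr
    rw [← measure_biUnion_finset (fun i _ j _ hij => hd hij) (fun j _ => hmeas j)]
    refine (measure_mono (Set.iUnion₂_subset fun j _ => Set.inter_subset_left)).trans_eq ?_
    rw [hJ, Real.volume_Ico, add_sub_cancel_left]
  have hRl : R ≤ l ^ (n - 1) := by
    have : R ≤ ∏ k ∈ Finset.univ.erase (0 : Fin n), l := by
      refine Finset.prod_le_prod' fun k _ => ?_
      refine (measure_mono Set.inter_subset_left).trans_eq ?_
      rw [Real.volume_Ico, add_sub_cancel_left]
    simpa [Finset.card_erase_of_mem] using this
  have hl0 : l ≠ 0 := by simpa [hl] using Q.side_pos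
  have hlt : l ≠ ⊤ := ENNReal.ofReal_ne_top
  rw [Q.volume_toSet, ← mul_pow_sub_one (NeZero.ne n) l]
  refine (mul_inv_mul_rpow_le hp hl0 hlt (pow_ne_zero _ hl0) (ENNReal.pow_ne_top hlt) hRl
    hYp).trans ?_
  rcases eq_or_ne R 0 with hR0 | hR0
  · rw [hR0, zero_mul]
    exact zero_le
  have hne : ∀ k, k ≠ 0 →
      (Set.Ico (Q.corner k) (Q.corner k + Q.side) ∩ Set.Ico 0 L).Nonempty := by
    intro k hk
    refine nonempty_of_measure_ne_zero (μ := volume) ?_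
    exact Finset.prod_ne_zero_iff.1 hR0 k (Finset.mem_erase.2 ⟨hk, Finset.mem_univ _⟩)
  rw [mul_comm, Finset.sum_mul]
  refine le_trans (Finset.sum_le_sum fun j hj => ?_)
    (Finset.sum_le_sum_of_subset (Finset.filter_subset _ _))
  obtain ⟨hjN, hj'⟩ := Finset.mem_filter.1 hj
  have hjN := Finset.mem_range.1 hjN
  gcongr
  exact baseMeasure_le_slabBoundary (h0 ▸ hx.monotone (Nat.zero_le j))
    (hN ▸ hx.monotone (hjN : j + 1 ≤ N)) hj' hne (hQ j hjN)

end Crossing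

/-! ### The energy of functions of the first coordinate and of their differences from averages -/

section Columns

variable {n : ℕ} [NeZero n]

lemma Cube.Ico_subset_of_toSet_subset_pi {n : ℕ} {Q : Cube n} {t : Fin n → Set ℝ}
    (h : Q.toSet ⊆ Set.univ.pi t) (k : Fin n) :
    Set.Ico (Q.corner k) (Q.corner k + Q.side) ⊆ t k := by
  intro y hy
  have hmem : Function.update Q.corner k y ∈ Q.toSet := by
    intro i _
    rcases eq_or_ne i k with rfl | hi
    · simpa using hy
    · simpa [hi] using Q.side_pos
  simpa using h hmem k trivial

lemma Ico_add_subset_Ico_iff {s l L : ℝ} (hl : 0 < l) (h : Set.Ico s (s + l) ⊆ Set.Ico 0 L) :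
    0 ≤ s ∧ s + l ≤ L :=
  (Set.Ico_subset_Ico_iff (by linarith)).1 h

/-- For cubes in `[0, L)ⁿ` and functions of the first coordinate, the `n`-dimensional sums are
controlled by the one-dimensional ones: above each point of the base `[0, L)^(n - 1)` the cubes
cut out a family of disjoint intervals. -/
lemma jnSum_comp_zero_le_jnModulus {p L a : ℝ} {f : ℝ → ℝ} (hf : IntegrableOn f (Set.Icc 0 L))
    {S : Set (Cube n)} (hS : IsDisjointFamily (Set.univ.pi fun _ => Set.Ico 0 L) S)
    (ha : ∀ Q ∈ S, Q.side ≤ a) :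
    jnSum p (fun x => f (x 0)) S
      ≤ ENNReal.ofReal L ^ (n - 1) * jnModulus p (closedInterval L) (fun x => f (x 0)) a := by
  classical
  have hc := hS.1.to_subtype
  have hsub : ∀ Q : S, ∀ k, Set.Ico ((Q : Cube n).corner k)
      ((Q : Cube n).corner k + (Q : Cube n).side) ⊆ Set.Ico 0 L := fun Q k =>
    Cube.Ico_subset_of_toSet_subset_pi (hS.2.2 Q Q.2) k
  have hbd : ∀ Q : S, 0 ≤ (Q : Cube n).corner 0 ∧ (Q : Cube n).corner 0 + (Q : Cube n).side ≤ L :=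
    fun Q => Ico_add_subset_Ico_iff (Q : Cube n).side_pos (hsub Q 0)
  set e : S → ℝ≥0∞ := fun Q =>
    intervalEnergy p f ((Q : Cube n).corner 0) ((Q : Cube n).corner 0 + (Q : Cube n).side) with he
  set t : S → Fin n → Set ℝ := fun Q k => if k = 0 then Set.univ else
    Set.Ico ((Q : Cube n).corner k) ((Q : Cube n).corner k + (Q : Cube n).side) with ht
  have htm : ∀ Q k, MeasurableSet (t Q k) := by
    intro Q k
    simp only [ht]
    split_ifs
    · exact MeasurableSet.univ
    · exact measurableSet_Ico
  have hρ : ∀ Q : S, faceMeasure L 0 0 (Set.univ.pi (t Q)) =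
      ENNReal.ofReal (Q : Cube n).side ^ (n - 1) := by
    intro Q
    rw [faceMeasure_pi L 0 (by simp [ht]) (htm Q)]
    have : ∀ k ∈ Finset.univ.erase (0 : Fin n), volume (t Q k ∩ Set.Ico 0 L) =
        ENNReal.ofReal (Q : Cube n).side := by
      intro k hk
      simp only [ht, if_neg (Finset.ne_of_mem_erase hk)]
      rw [Set.inter_eq_left.2 (hsub Q k), Real.volume_Ico, add_sub_cancel_left]
    rw [Finset.prod_congr rfl this]
    simp [Finset.card_erase_of_mem]
  have hpt : ∀ y : Fin n → ℝ, ∑' Q : S, (Set.univ.pi (t Q)).indicator (fun _ => e Q) y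
      ≤ jnModulus p (closedInterval L) (fun x => f (x 0)) a := by
    intro y
    have h1 : ∑' Q : S, (Set.univ.pi (t Q)).indicator (fun _ => e Q) y =
        ∑' Q : {Q : S | y ∈ Set.univ.pi (t Q)}, e Q := by
      rw [tsum_subtype {Q : S | y ∈ Set.univ.pi (t Q)} e]
      rfl
    rw [h1]
    refine tsum_intervalEnergy_le_jnModulus hf
      (fun Q : {Q : S | y ∈ Set.univ.pi (t Q)} => (Q.1 : Cube n).corner 0)
      (fun Q => (Q.1 : Cube n).side) (fun Q => (Q.1 : Cube n).side_pos) (fun Q => ha _ Q.1.2)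
      (fun Q => (hbd Q.1).1) (fun Q => (hbd Q.1).2) ?_
    intro Q R hQR
    refine Set.disjoint_left.2 fun z hzQ hzR => ?_
    have hmem : ∀ Q : {Q : S | y ∈ Set.univ.pi (t Q)},
        z ∈ Set.Ico ((Q.1 : Cube n).corner 0) ((Q.1 : Cube n).corner 0 + (Q.1 : Cube n).side) →
        Function.update y 0 z ∈ (Q.1 : Cube n).toSet := by
      intro Q hz i _
      rcases eq_or_ne i 0 with rfl | hi
      · simpa using hz
      · have := Q.2 i trivial
        simp only [ht, if_neg hi] at this
        simpa [hi] using this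
    have hne : (Q.1 : Cube n) ≠ R.1 := fun h => hQR (Subtype.ext (Subtype.ext h))
    exact Set.disjoint_left.1 (hS.2.1 Q.1.2 R.1.2 hne) (hmem Q hzQ) (hmem R hzR)
  calc jnSum p (fun x => f (x 0)) S
      = ∑' Q : S, ∫⁻ y, (Set.univ.pi (t Q)).indicator (fun _ => e Q) y ∂(faceMeasure L 0 0) := by
        rw [jnSum_eq_tsum_cubeEnergy]
        refine tsum_congr fun Q => ?_
        rw [cubeEnergy_comp_zero, lintegral_indicator_const (MeasurableSet.univ_pi (htm Q)), hρ,
          mul_comm]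
        exact hf.mono_set ((hsub Q 0).trans Set.Ico_subset_Icc_self)
    _ = ∫⁻ y, ∑' Q : S, (Set.univ.pi (t Q)).indicator (fun _ => e Q) y ∂(faceMeasure L 0 0) := by
        rw [lintegral_tsum]
        exact fun Q => (measurable_const.indicator (MeasurableSet.univ_pi (htm Q))).aemeasurable
    _ ≤ ∫⁻ _, jnModulus p (closedInterval L) (fun x => f (x 0)) a ∂(faceMeasure L 0 0) :=
        lintegral_mono hpt
    _ = _ := by rw [lintegral_const, faceMeasure_univ, mul_comm]

/-- The step function whose value on each of the cells `[x j, x (j + 1))`, `j < N`, is the average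
of `f` over this cell. -/
def stepAverage (f : ℝ → ℝ) (x : ℕ → ℝ) (N : ℕ) (y : ℝ) : ℝ :=
  ∑ j ∈ Finset.range N, (Set.Ico (x j) (x (j + 1))).indicator
    (fun _ => ⨍ z in Set.Ico (x j) (x (j + 1)), f z) y

lemma stepAverage_of_mem {f : ℝ → ℝ} {x : ℕ → ℝ} (hx : Monotone x) {N j : ℕ} (hj : j < N) {y : ℝ}
    (hy : y ∈ Set.Ico (x j) (x (j + 1))) :
    stepAverage f x N y = ⨍ z in Set.Ico (x j) (x (j + 1)), f z := by
  unfold stepAverage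
  rw [Finset.sum_eq_single_of_mem j (Finset.mem_range.2 hj), Set.indicator_of_mem hy]
  intro i _ hij
  exact Set.indicator_of_notMem
    (fun hyi => Set.disjoint_left.1 (hx.pairwise_disjoint_on_Ico_succ hij) hyi hy) _

lemma measurable_stepAverage (f : ℝ → ℝ) (x : ℕ → ℝ) (N : ℕ) :
    Measurable (stepAverage f x N) :=
  Finset.measurable_fun_sum _ fun _ _ => measurable_const.indicator measurableSet_Ico

lemma abs_stepAverage_le (f : ℝ → ℝ) (x : ℕ → ℝ) (N : ℕ) (y : ℝ) :
    |stepAverage f x N y| ≤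
      ∑ j ∈ Finset.range N, |⨍ z in Set.Ico (x j) (x (j + 1)), f z| := by
  refine (Finset.abs_sum_le_sum_abs _ _).trans (Finset.sum_le_sum fun j _ => ?_)
  by_cases hy : y ∈ Set.Ico (x j) (x (j + 1))
  · rw [Set.indicator_of_mem hy]
  · rw [Set.indicator_of_notMem hy, abs_zero]
    exact abs_nonneg _

lemma integrable_columnExt {L : ℝ} {v : ℝ → ℝ} (hv : IntegrableOn v (Set.Ico 0 L)) :
    Integrable (columnExt n L v) :=
  (integrable_indicator_iff (MeasurableSet.univ_pi fun _ => measurableSet_Ico)).2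
    (integrableOn_pi_comp_zero (fun _ => by simp) hv)

lemma columnExt_congr {L : ℝ} {v w : ℝ → ℝ} (h : ∀ y ∈ Set.Ico 0 L, v y = w y) :
    columnExt n L v = columnExt n L w :=
  Set.indicator_congr fun x hx => h (x 0) (hx 0 trivial)

/-- The constant in `jnSum_columnExt_sub_stepAverage_le`. -/
def columnConst (n : ℕ) (p L : ℝ) : ℝ≥0∞ :=
  ENNReal.ofReal L ^ (n - 1) + 2 ^ p * (morreyConst p * (2 * n * ENNReal.ofReal L ^ (n - 1)))

lemma columnConst_ne_top {n : ℕ} {p L : ℝ} (hp : 0 ≤ p) : columnConst n p L ≠ ⊤ := by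
  unfold columnConst morreyConst
  have h2 : (2 : ℝ≥0∞) ^ p ≠ ⊤ := ENNReal.rpow_ne_top_of_nonneg hp (by simp)
  have hL : ENNReal.ofReal L ^ (n - 1) ≠ ⊤ := ENNReal.pow_ne_top ENNReal.ofReal_ne_top
  have h3 : (2 : ℝ≥0∞) * n ≠ ⊤ := ENNReal.mul_ne_top (by simp) (by simp)
  exact ENNReal.add_ne_top.2 ⟨hL, ENNReal.mul_ne_top h2
    (ENNReal.mul_ne_top ENNReal.ofReal_ne_top (ENNReal.mul_ne_top h3 hL))⟩

/-- The main estimate: subtracting from `f` its averages over the cells of a fine partition leaves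
a function whose extension by zero has small seminorm on the whole space. Cubes inside one slab
only see the oscillation of `f`, the other cubes are handled by the Morrey bounds on the cells. -/
lemma jnSum_columnExt_sub_stepAverage_le {p L a : ℝ} (hp : 1 < p) {f : ℝ → ℝ}
    (hf : IntegrableOn f (Set.Icc 0 L)) {N : ℕ} {x : ℕ → ℝ} (hx : StrictMono x) (h0 : x 0 = 0)
    (hN : x N = L) (ha : ∀ j, x (j + 1) - x j ≤ a) {S : Set (Cube n)}
    (hS : IsDisjointFamily Set.univ S) :
    jnSum p (columnExt n L fun y => f y - stepAverage f x N y) S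
      ≤ columnConst n p L * jnModulus p (closedInterval L) (fun y => f (y 0)) a := by
  classical
  set W := jnModulus p (closedInterval L) (fun y => f (y 0)) a with hW
  set I : ℕ → Set ℝ := fun j => Set.Ico (x j) (x (j + 1)) with hI
  have hIL : ∀ j < N, I j ⊆ Set.Ico 0 L := fun j hj =>
    Set.Ico_subset_Ico (h0 ▸ hx.monotone (Nat.zero_le j)) (hN ▸ hx.monotone (hj : j + 1 ≤ N))
  have hfI : IntegrableOn f (Set.Ico 0 L) := hf.mono_set Set.Ico_subset_Icc_self
  -- A globally measurable representative of `f - stepAverage f x N` on `[0, L)`.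
  set v : ℝ → ℝ := fun y => (Set.Ico 0 L).indicator f y - stepAverage f x N y with hv
  have hvm : AEStronglyMeasurable v :=
    ((integrable_indicator_iff measurableSet_Ico).2 hfI).aestronglyMeasurable.sub
      (measurable_stepAverage f x N).aestronglyMeasurable
  have hvI : ∀ j < N, ∀ y ∈ I j, v y = f y - ⨍ z in I j, f z := by
    intro j hj y hy
    simp only [hv]
    rw [Set.indicator_of_mem (hIL j hj hy), stepAverage_of_mem hx.monotone hj hy]
  have hstep : IntegrableOn (stepAverage f x N) (Set.Ico 0 L) := by
    have : IsFiniteMeasure ((volume : Measure ℝ).restrict (Set.Ico 0 L)) := ⟨by simp⟩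
    exact Integrable.of_bound (measurable_stepAverage f x N).aestronglyMeasurable _
      (ae_of_all _ fun y => abs_stepAverage_le f x N y)
  have hvint : IntegrableOn v (Set.Ico 0 L) := by
    refine Integrable.sub ?_ hstep
    exact ((integrable_indicator_iff measurableSet_Ico).2 hfI).integrableOn
  rw [columnExt_congr (n := n) (w := v) (fun y hy => by simp [hv, Set.indicator_of_mem hy])]
  set M : ℕ → ℝ≥0∞ := fun j => morreyConst p * maxIntervalEnergy p f (x j) (x (j + 1)) with hM
  have hMbound : ∀ j < N, ∀ s t, x j ≤ s → s < t → t ≤ x (j + 1) →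
      (∫⁻ y in Set.Ico s t, ‖v y‖ₑ) ^ p ≤ M j * ENNReal.ofReal (t - s) ^ (p - 1) := by
    intro j hj s t hs hst ht
    rw [setLIntegral_congr_fun measurableSet_Ico (g := fun y => ‖f y - ⨍ z in I j, f z‖ₑ)
      fun y hy => by rw [hvI j hj y (Set.Ico_subset_Ico hs ht hy)]]
    exact lintegral_sub_average_rpow_le hp (hfI.mono_set (hIL j hj)) hs hst ht
  set G : Set (Cube n) := {Q | ∃ j < N, Q.toSet ⊆ slab n L (x j) (x (j + 1))} with hG
  have hgood : ∀ Q ∈ G, cubeEnergy p (columnExt n L v) Q = cubeEnergy p (fun y => f (y 0)) Q := by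
    rintro Q ⟨j, hj, hQ⟩
    have hQbox : ∀ y ∈ Q.toSet, y ∈ Set.univ.pi fun _ : Fin n => Set.Ico 0 L := by
      intro y hy i _
      rcases eq_or_ne i 0 with rfl | hi
      · exact hIL j hj (hQ hy).1
      · exact (hQ hy).2 i hi
    have h1 : cubeEnergy p (columnExt n L v) Q =
        cubeEnergy p (fun y => f (y 0) + -(⨍ z in I j, f z)) Q := by
      refine cubeEnergy_congr (ae_of_all _ fun y hy => ?_)
      rw [columnExt, Set.indicator_of_mem (hQbox y hy), hvI j hj _ (hQ hy).1, sub_eq_add_neg]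
    have hi : IntegrableOn (fun y : Fin n → ℝ => f (y 0)) Q.toSet :=
      (integrableOn_pi_comp_zero (fun _ => by simp) hfI).mono_set hQbox
    rw [h1, cubeEnergy, cubeEnergy, meanOsc_add_const hi]
  have hterm : ∀ Q : Cube n, cubeEnergy p (columnExt n L v) Q ≤
      G.indicator (cubeEnergy p fun y => f (y 0)) Q +
        2 ^ p * ∑ j ∈ Finset.range N, M j * slabBoundary n L (x j) (x (j + 1)) Q.toSet := by
    intro Q
    by_cases hQ : Q ∈ G
    · rw [Set.indicator_of_mem hQ, hgood Q hQ]
      exact le_self_add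
    · refine le_trans ?_ le_add_self
      refine (cubeEnergy_le_two_rpow_mul (by linarith)
        (integrable_columnExt hvint).integrableOn).trans ?_
      gcongr
      refine volume_mul_average_columnExt_rpow_le hp hvm hx h0 hN hMbound fun j hj hQj => ?_
      exact hQ ⟨j, hj, hQj⟩
  have hgoodsum : ∑' Q : S, G.indicator (cubeEnergy p fun y => f (y 0)) (Q : Cube n)
      ≤ ENNReal.ofReal L ^ (n - 1) * W := by
    have h1 : ∑' Q : S, G.indicator (cubeEnergy p fun y => f (y 0)) (Q : Cube n) =
        jnSum p (fun y => f (y 0)) (S ∩ G) := by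
      rw [jnSum_eq_tsum_cubeEnergy, tsum_subtype S (G.indicator (cubeEnergy p fun y => f (y 0))),
        tsum_subtype (S ∩ G) (cubeEnergy p fun y => f (y 0)), Set.indicator_indicator]
    rw [h1]
    refine jnSum_comp_zero_le_jnModulus hf ⟨hS.1.mono Set.inter_subset_left,
      hS.2.1.subset Set.inter_subset_left, ?_⟩ ?_
    · rintro Q ⟨_, j, hj, hQ⟩ y hy i _
      rcases eq_or_ne i 0 with rfl | hi
      · exact hIL j hj (hQ hy).1
      · exact (hQ hy).2 i hi
    · rintro Q ⟨_, j, hj, hQ⟩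
      have h2 : Set.Ico (Q.corner 0) (Q.corner 0 + Q.side) ⊆ I j :=
        Cube.Ico_subset_of_toSet_subset_pi
          (t := fun i => if i = 0 then I j else Set.univ) (fun y hy i _ => by
            rcases eq_or_ne i 0 with rfl | hi
            · simpa [hI] using (hQ hy).1
            · simp [hi]) 0 |>.trans (by simp)
      have h3 := (Set.Ico_subset_Ico_iff (by linarith [Q.side_pos])).1 h2
      linarith [ha j]
  have hbadsum : ∑' Q : S, ∑ j ∈ Finset.range N,
      M j * slabBoundary n L (x j) (x (j + 1)) (Q : Cube n).toSet
      ≤ morreyConst p * (2 * n * ENNReal.ofReal L ^ (n - 1)) * W := by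
    rw [Summable.tsum_finsetSum fun _ _ => ENNReal.summable]
    calc ∑ j ∈ Finset.range N, ∑' Q : S,
          M j * slabBoundary n L (x j) (x (j + 1)) (Q : Cube n).toSet
        ≤ ∑ j ∈ Finset.range N, M j * (2 * n * ENNReal.ofReal L ^ (n - 1)) := by
          refine Finset.sum_le_sum fun j _ => ?_
          rw [ENNReal.tsum_mul_left, ← slabBoundary_univ L (x j) (x (j + 1))]
          gcongr
          exact hS.tsum_measure_le _
      _ = morreyConst p * (2 * n * ENNReal.ofReal L ^ (n - 1)) *
            ∑ j ∈ Finset.range N, maxIntervalEnergy p f (x j) (x (j + 1)) := by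
          rw [Finset.mul_sum]
          refine Finset.sum_congr rfl fun j _ => ?_
          simp only [hM]
          ring
      _ ≤ _ := by
          gcongr
          exact sum_maxIntervalEnergy_le_jnModulus hf hx h0 hN ha
  calc jnSum p (columnExt n L v) S
      ≤ ∑' Q : S, (G.indicator (cubeEnergy p fun y => f (y 0)) (Q : Cube n) +
        2 ^ p * ∑ j ∈ Finset.range N,
          M j * slabBoundary n L (x j) (x (j + 1)) (Q : Cube n).toSet) := by
        rw [jnSum_eq_tsum_cubeEnergy]
        exact ENNReal.tsum_le_tsum fun Q => hterm Q
    _ ≤ ENNReal.ofReal L ^ (n - 1) * W +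
          2 ^ p * (morreyConst p * (2 * n * ENNReal.ofReal L ^ (n - 1)) * W) := by
        rw [ENNReal.tsum_add, ENNReal.tsum_mul_left]
        gcongr
    _ = _ := by
        rw [columnConst]
        ring

end Columns

/-! ### Approximation by smooth functions with compact support -/

section Approximation

variable {n : ℕ}

lemma memJN_of_hasCompactSupport {p : ℝ} (hp : 1 < p) {g : (Fin n → ℝ) → ℝ}
    (hg : ContDiff ℝ ∞ g) (hc : HasCompactSupport g) : MemJN p g := by
  have hp0 : 0 < p := by linarith
  have hli : LocallyIntegrable g := hg.continuous.locallyIntegrable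
  refine ⟨hli, (jnNorm_le hp0 fun S hS => jnSum_le_lintegral_rpow hp hli hS).trans_lt ?_⟩
  have hLp : MemLp g (ENNReal.ofReal p) := hg.continuous.memLp_of_hasCompactSupport hc
  have h1 := lintegral_rpow_enorm_lt_top_of_eLpNorm_lt_top (by simpa using hp0)
    ENNReal.ofReal_ne_top hLp.eLpNorm_lt_top
  rw [ENNReal.toReal_ofReal hp0.le] at h1
  exact ENNReal.rpow_lt_top_of_nonneg (by positivity)
    (ENNReal.mul_ne_top (ENNReal.rpow_ne_top_of_nonneg hp0.le (by simp)) h1.ne)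

lemma exists_contDiff_lintegral_rpow_le {p : ℝ} (hp : 1 < p) {b : (Fin n → ℝ) → ℝ}
    (hb : MemLp b (ENNReal.ofReal p)) {η : ℝ≥0∞} (hη : η ≠ 0) (hη' : η ≠ ⊤) :
    ∃ g : (Fin n → ℝ) → ℝ, ContDiff ℝ ∞ g ∧ HasCompactSupport g ∧
      ∫⁻ x, ‖b x - g x‖ₑ ^ p ≤ η := by
  have hp0 : 0 < p := by linarith
  have he0 : η ^ (1 / p) ≠ 0 := by simp [hη, hη']
  have het : η ^ (1 / p) ≠ ⊤ := ENNReal.rpow_ne_top_of_nonneg (by positivity) hη'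
  obtain ⟨g, hgc, hgs, hg⟩ := hb.exist_eLpNorm_sub_le ENNReal.ofReal_ne_top
    (by simpa using hp.le) (ENNReal.toReal_pos he0 het)
  refine ⟨g, hgs, hgc, ?_⟩
  rw [ENNReal.ofReal_toReal het, eLpNorm_eq_lintegral_rpow_enorm_toReal (by simpa using hp0)
    ENNReal.ofReal_ne_top, ENNReal.toReal_ofReal hp0.le,
    ENNReal.rpow_le_rpow_iff (by positivity)] at hg
  exact hg

/-- A function that is, up to constants and up to small errors in `JN_p`, in `L^p` belongs
to `CJN_p`. -/
lemma memCJN_of_forall_exists_memLp {p : ℝ} (hp : 1 < p) {h : (Fin n → ℝ) → ℝ}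
    (H : ∀ η : ℝ≥0∞, η ≠ 0 → ∃ w b : (Fin n → ℝ) → ℝ, ∃ c : ℝ, LocallyIntegrable w ∧
      (∀ S, IsDisjointFamily Set.univ S → jnSum p w S ≤ η) ∧ MemLp b (ENNReal.ofReal p) ∧
      h =ᵐ[volume] fun x => w x + b x + c) : MemCJN p h := by
  have hp0 : 0 < p := by linarith
  have h2 : (2 : ℝ≥0∞) ^ p ≠ 0 := by simp
  have h2' : (2 : ℝ≥0∞) ^ p ≠ ⊤ := ENNReal.rpow_ne_top_of_nonneg hp0.le (by simp)
  -- A bound on all sums `jnSum`: for `δ = 1` it gives the finiteness of the seminorm of `h`, for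
  -- small `δ` the approximation.
  have key : ∀ δ : ℝ≥0∞, δ ≠ 0 → δ ≠ ⊤ → ∃ g : (Fin n → ℝ) → ℝ, ContDiff ℝ ∞ g ∧
      HasCompactSupport g ∧ LocallyIntegrable h ∧
      ∀ S, IsDisjointFamily Set.univ S → jnSum p (fun x => h x - g x) S ≤ δ := by
    intro δ hδ hδ'
    set η := δ / 2 ^ p with hηdef
    have hη : η ≠ 0 := ENNReal.div_ne_zero.2 ⟨hδ, h2'⟩
    have hη' : η ≠ ⊤ := ENNReal.div_ne_top hδ' h2
    obtain ⟨w, b, c, hw, hwS, hb, hh⟩ := H η hη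
    obtain ⟨g, hgs, hgc, hg⟩ := exists_contDiff_lintegral_rpow_le hp hb (η := η / 2 ^ p)
      (ENNReal.div_ne_zero.2 ⟨hη, h2'⟩) (ENNReal.div_ne_top hη' h2)
    have hbl : LocallyIntegrable b := hb.locallyIntegrable (by simpa using hp.le)
    have hgl : LocallyIntegrable g := hgs.continuous.locallyIntegrable
    have hbg : LocallyIntegrable fun x => b x - g x := hbl.sub hgl
    have hwbg : LocallyIntegrable fun x => w x + (b x - g x) := hw.add hbg
    have hcl : LocallyIntegrable fun _ : Fin n → ℝ => c := locallyIntegrable_const c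
    refine ⟨g, hgs, hgc, ((hw.add hbl).add hcl).congr hh.symm, fun S hS => ?_⟩
    have hI : ∀ {k : (Fin n → ℝ) → ℝ}, LocallyIntegrable k →
        ∀ Q ∈ S, IntegrableOn k (Q : Cube n).toSet :=
      fun hk Q _ => Q.integrableOn_of_locallyIntegrable hk
    have hae : (fun x => h x - g x) =ᵐ[volume] fun x => (w x + (b x - g x)) + c := by
      filter_upwards [hh] with x hx
      rw [hx]
      ring
    rw [jnSum_congr hae, jnSum_add_const p (hI hwbg) c]
    calc jnSum p (fun x => w x + (b x - g x)) S
        ≤ 2 ^ (p - 1) * (jnSum p w S + jnSum p (fun x => b x - g x) S) :=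
          jnSum_add_le hp.le (hI hw) (hI hbg)
      _ ≤ 2 ^ (p - 1) * (η + 2 ^ p * (η / 2 ^ p)) := by
          gcongr
          · exact hwS S hS
          · exact (jnSum_le_lintegral_rpow hp hbg hS).trans (by gcongr)
      _ = 2 ^ p * η := by
          rw [ENNReal.mul_div_cancel h2 h2', ← two_mul, ← mul_assoc]
          congr 1
          nth_rewrite 2 [← ENNReal.rpow_one 2]
          rw [← ENNReal.rpow_add _ _ (by simp) (by simp), sub_add_cancel]
      _ = δ := ENNReal.mul_div_cancel h2 h2'
  refine ⟨?_, fun ε hε => ?_⟩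
  · obtain ⟨g, hgs, hgc, hl, hS⟩ := key 1 one_ne_zero ENNReal.one_ne_top
    have hgJ := memJN_of_hasCompactSupport hp hgs hgc
    have hhg : LocallyIntegrable fun x => h x - g x := hl.sub hgJ.1
    refine ⟨hl, (jnNorm_le (K := 2 ^ (p - 1) * (1 + jnNorm p Set.univ g ^ p)) hp0
      fun S hSd => ?_).trans_lt ?_⟩
    · have h1 : h = fun x => (h x - g x) + g x := by
        funext x
        ring
      rw [h1]
      refine (jnSum_add_le hp.le (fun Q _ => Q.integrableOn_of_locallyIntegrable hhg)
        (fun Q _ => Q.integrableOn_of_locallyIntegrable hgJ.1)).trans ?_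
      gcongr
      · exact hS S hSd
      · exact jnSum_le_jnNorm_rpow hp0 hSd
    · refine ENNReal.rpow_lt_top_of_nonneg (by positivity) (ENNReal.mul_ne_top
        (ENNReal.rpow_ne_top_of_nonneg (by linarith) (by simp)) (ENNReal.add_ne_top.2
        ⟨ENNReal.one_ne_top, ENNReal.rpow_ne_top_of_nonneg hp0.le hgJ.2.ne⟩))
  · obtain ⟨ε', hε', hε'lt⟩ := exists_between hε
    have hε't : ε' ≠ ⊤ := (hε'lt.trans_le le_top).ne
    obtain ⟨g, hgs, hgc, hl, hS⟩ := key (ε' ^ p) (by simp [hε'.ne', hp0.le])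
      (ENNReal.rpow_ne_top_of_nonneg hp0.le hε't)
    refine ⟨g, ⟨hgs, hgc⟩, memJN_of_hasCompactSupport hp hgs hgc,
      (jnNorm_le hp0 hS).trans_lt ?_⟩
    rwa [← ENNReal.rpow_mul, mul_one_div_cancel hp0.ne', ENNReal.rpow_one]

end Approximation

section HatApproximation

variable {n : ℕ} [NeZero n]

/-- Up to a null set, `f̂` splits into a part of small seminorm, an `L^p` part and a constant. -/
lemma hat_ae_eq {L : ℝ} (f u : ℝ → ℝ) :
    hat n L f =ᵐ[volume] fun x => columnExt n L (fun y => f y - u y) x +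
      columnExt n L (fun y => u y - ⨍ t in Set.Icc 0 L, f t) x + ⨍ t in Set.Icc 0 L, f t := by
  have h := Measure.univ_pi_Ico_ae_eq_Icc (μ := fun _ : Fin n => (volume : Measure ℝ))
    (f := fun _ => 0) (g := fun _ => L)
  rw [← volume_pi] at h
  filter_upwards [h] with x hx
  have hiff : x ∈ Set.univ.pi (fun _ : Fin n => Set.Ico 0 L) ↔ ∀ i, 0 ≤ x i ∧ x i ≤ L := by
    rw [show (x ∈ Set.univ.pi fun _ : Fin n => Set.Ico 0 L) ↔
      x ∈ Set.Icc (fun _ : Fin n => (0 : ℝ)) (fun _ => L) from iff_of_eq hx]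
    exact ⟨fun h i => ⟨h.1 i, h.2 i⟩, fun h => ⟨fun i => (h i).1, fun i => (h i).2⟩⟩
  by_cases hm : x ∈ Set.univ.pi (fun _ : Fin n => Set.Ico 0 L)
  · rw [hat, if_pos (hiff.1 hm), columnExt, columnExt, Set.indicator_of_mem hm,
      Set.indicator_of_mem hm]
    ring
  · rw [hat, if_neg fun h => hm (hiff.2 h), columnExt, columnExt, Set.indicator_of_notMem hm,
      Set.indicator_of_notMem hm]
    ring

lemma memLp_columnExt {L C : ℝ} (q : ℝ≥0∞) {u : ℝ → ℝ} (hu : Measurable u)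
    (hC : ∀ y, |u y| ≤ C) : MemLp (columnExt n L u) q := by
  rw [columnExt, memLp_indicator_iff_restrict (MeasurableSet.univ_pi fun _ => measurableSet_Ico)]
  have : IsFiniteMeasure ((volume : Measure (Fin n → ℝ)).restrict
      (Set.univ.pi fun _ => Set.Ico 0 L)) := by
    refine ⟨?_⟩
    rw [Measure.restrict_apply_univ, Real.volume_pi_Ico]
    exact ENNReal.prod_lt_top fun _ _ => ENNReal.ofReal_lt_top
  exact MemLp.of_bound (hu.comp (measurable_pi_apply 0)).aestronglyMeasurable C
    (ae_of_all _ fun x => hC (x 0))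

/-- Membership of `f̂` in `CJN_p`: the error of the step functions on uniform partitions is small
because the modulus of vanishing of `f` at the mesh size is small. -/
lemma memCJN_hat {p L : ℝ} (hp : 1 < p) (hL : 0 < L) {f : ℝ → ℝ}
    (hf : IntegrableOn f (Set.Icc 0 L)) (hV : MemVJNInterval p L f) :
    MemCJN p (hat n L f) := by
  refine memCJN_of_forall_exists_memLp hp fun η hη => ?_
  have hlim : Tendsto (jnModulus p (closedInterval L) fun y => f (y 0)) (𝓝[>] 0) (𝓝 0) := hV.2
  have hK : columnConst n p L ≠ ⊤ := columnConst_ne_top (by linarith)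
  have hmesh : Tendsto (fun k : ℕ => L / ((k : ℝ) + 1)) atTop (𝓝[>] 0) := by
    refine tendsto_nhdsWithin_iff.2 ⟨?_, Eventually.of_forall fun k => ?_⟩
    · exact ((tendsto_const_div_atTop_nhds_zero_nat L).comp (tendsto_add_atTop_nat 1)).congr
        fun k => by simp
    · exact div_pos hL (by positivity)
  have hlim' := (ENNReal.Tendsto.const_mul hlim (Or.inr hK)).comp hmesh
  rw [mul_zero] at hlim'
  obtain ⟨k, hk⟩ := ((ENNReal.tendsto_nhds_zero.1 hlim') η (pos_iff_ne_zero.2 hη)).exists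
  set a := L / ((k : ℝ) + 1) with ha
  have ha0 : 0 < a := div_pos hL (by positivity)
  set x : ℕ → ℝ := fun j => j * a with hx
  have hxm : StrictMono x := fun i j hij => by
    have : (i : ℝ) < j := by exact_mod_cast hij
    simp only [hx]
    gcongr
  have hxN : x (k + 1) = L := by
    simp only [hx, ha]
    push_cast
    field_simp
  have hfI : IntegrableOn f (Set.Ico 0 L) := hf.mono_set Set.Ico_subset_Icc_self
  set u := stepAverage f x (k + 1) with hu
  have hum : Measurable u := measurable_stepAverage f x (k + 1)
  have huI : IntegrableOn u (Set.Ico 0 L) := by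
    have : IsFiniteMeasure ((volume : Measure ℝ).restrict (Set.Ico 0 L)) := ⟨by simp⟩
    exact Integrable.of_bound hum.aestronglyMeasurable _
      (ae_of_all _ fun y => abs_stepAverage_le f x (k + 1) y)
  refine ⟨columnExt n L fun y => f y - u y,
    columnExt n L fun y => u y - ⨍ t in Set.Icc 0 L, f t, ⨍ t in Set.Icc 0 L, f t,
    (integrable_columnExt (Integrable.sub hfI huI)).locallyIntegrable, fun S hS => ?_, ?_,
    hat_ae_eq f u⟩
  · refine (jnSum_columnExt_sub_stepAverage_le (a := a) hp hf hxm (by simp [hx]) hxN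
      (fun j => ?_) hS).trans hk
    simp only [hx]
    push_cast
    linarith
  · exact memLp_columnExt _ (hum.sub_const _) fun y =>
      (abs_sub _ _).trans (add_le_add (abs_stepAverage_le f x (k + 1) y) le_rfl)

end HatApproximation

/-! ### Restriction to the interval -/

section Restriction

variable {n : ℕ}

/-- The closed cube `[0, L]ⁿ`. -/
def closedBox (n : ℕ) (L : ℝ) : Set (Fin n → ℝ) := {x | ∀ i, 0 ≤ x i ∧ x i ≤ L}

/-- A continuous function has small sums over families of small cubes in a bounded cube. -/
lemma exists_forall_jnSum_le_of_continuous {p L : ℝ} (hp : 0 < p) {g : (Fin n → ℝ) → ℝ}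
    (hg : Continuous g) {ε : ℝ≥0∞} (hε : ε ≠ 0) :
    ∃ a > 0, ∀ S, IsDisjointFamily (closedBox n L) S → (∀ Q ∈ S, Q.side ≤ a) →
      jnSum p g S ≤ ε := by
  have hbox : closedBox n L = Set.Icc (fun _ => 0) (fun _ => L) := by
    ext x
    exact ⟨fun h => ⟨fun i => (h i).1, fun i => (h i).2⟩, fun h i => ⟨h.1 i, h.2 i⟩⟩
  have hcomp : IsCompact (closedBox n L) := hbox ▸ isCompact_Icc
  have hvol : volume (closedBox n L) ≠ ⊤ := hcomp.measure_lt_top.ne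
  have hlim : Tendsto (fun η : ℝ => volume (closedBox n L) * ENNReal.ofReal (2 * η) ^ p)
      (𝓝[>] 0) (𝓝 0) := by
    have h1 : Tendsto (fun η : ℝ => ENNReal.ofReal (2 * η) ^ p) (𝓝 0) (𝓝 0) := by
      have : Continuous fun η : ℝ => ENNReal.ofReal (2 * η) ^ p :=
        ENNReal.continuous_rpow_const.comp (ENNReal.continuous_ofReal.comp (by fun_prop))
      simpa [hp] using this.tendsto 0
    simpa using (ENNReal.Tendsto.const_mul h1 (Or.inr hvol)).mono_left nhdsWithin_le_nhds
  obtain ⟨η, hη, hη0⟩ := (((ENNReal.tendsto_nhds_zero.1 hlim) ε (pos_iff_ne_zero.2 hε)).and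
    self_mem_nhdsWithin).exists
  have hη0 : 0 < η := hη0
  obtain ⟨δ, hδ, H⟩ := Metric.uniformContinuousOn_iff_le.1
    (hcomp.uniformContinuousOn_of_continuous hg.continuousOn) η hη0
  refine ⟨δ, hδ, fun S hS hSa => ?_⟩
  have hosc : ∀ Q ∈ S, meanOsc g Q ≤ 2 * η := by
    intro Q hQ
    have hi : IntegrableOn g Q.toSet := Q.integrableOn_of_locallyIntegrable hg.locallyIntegrable
    have hi' : IntegrableOn (fun x => g x + -g Q.corner) Q.toSet :=
      Integrable.add hi (Q.integrableOn_const _)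
    rw [← meanOsc_add_const hi (-g Q.corner)]
    refine (meanOsc_le_two_mul hi').trans ?_
    gcongr
    rw [← Q.setAverage_const η]
    refine Q.setAverage_mono hi'.abs (Q.integrableOn_const _) fun x hx => ?_
    rw [← sub_eq_add_neg, ← Real.dist_eq]
    refine H x (hS.2.2 Q hQ hx) Q.corner (hS.2.2 Q hQ Q.corner_mem) ?_
    refine ((dist_pi_le_iff Q.side_pos.le).2 fun i => ?_).trans (hSa Q hQ)
    have := hx i trivial
    rw [Real.dist_eq, abs_of_nonneg (by linarith [this.1])]
    linarith [this.2]
  calc jnSum p g S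
      ≤ ∑' Q : S, volume (Q : Cube n).toSet * ENNReal.ofReal (2 * η) ^ p := by
        rw [jnSum_eq_tsum_cubeEnergy]
        refine ENNReal.tsum_le_tsum fun Q => ?_
        unfold cubeEnergy
        gcongr
        exact hosc Q Q.2
    _ ≤ volume (closedBox n L) * ENNReal.ofReal (2 * η) ^ p := by
        rw [ENNReal.tsum_mul_right]
        gcongr
        exact hS.tsum_measure_le volume
    _ ≤ ε := hη

/-- As many disjoint intervals of length `l ≤ L` as fit into `[0, L]` fill at least half of it. -/
lemma ofReal_half_le_floor_mul {l L : ℝ} (hl : 0 < l) (hlL : l ≤ L) :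
    ENNReal.ofReal (L / 2) ≤ (⌊L / l⌋₊ : ℝ≥0∞) * ENNReal.ofReal l := by
  rw [← ENNReal.ofReal_natCast, ← ENNReal.ofReal_mul (Nat.cast_nonneg _)]
  refine ENNReal.ofReal_le_ofReal ?_
  have h1 : L / l < ⌊L / l⌋₊ + 1 := Nat.lt_floor_add_one _
  have h2 : (1 : ℝ) ≤ ⌊L / l⌋₊ := by
    exact_mod_cast Nat.le_floor (by rw [Nat.cast_one]; exact (one_le_div hl).2 hlL)
  have h3 : L < (⌊L / l⌋₊ + 1) * l := (div_lt_iff₀ hl).1 h1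
  nlinarith

variable [NeZero n]

/-- Stacking: above each interval `J` of a disjoint family in `[0, L]` there are disjoint cubes
`J × K` in `[0, L]ⁿ`, with `K` in a grid that fills at least `2^(1 - n)` of `[0, L]^(n - 1)`. -/
lemma exists_stacked_family {p L : ℝ} {f : ℝ → ℝ} (hf : IntegrableOn f (Set.Icc 0 L))
    {S : Set (Cube 1)} (hS : IsDisjointFamily (closedInterval L) S) :
    ∃ T : Set (Cube n), IsDisjointFamily (closedBox n L) T ∧
      (∀ Q ∈ T, ∃ J ∈ S, Q.side = J.side) ∧
      ENNReal.ofReal (L / 2) ^ (n - 1) * jnSum p (fun x => f (x 0)) S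
        ≤ jnSum p (fun x => f (x 0)) T := by
  classical
  have hc := hS.1.to_subtype
  have hcor : ∀ J : S, 0 ≤ (J : Cube 1).corner 0 := fun J =>
    (hS.2.2 J J.2 (J : Cube 1).corner_mem 0).1
  have hend : ∀ J : S, (J : Cube 1).corner 0 + (J : Cube 1).side ≤ L := fun J =>
    (J : Cube 1).corner_add_side_le fun x hx => (hS.2.2 J J.2 hx 0).2
  have hside : ∀ J : S, 0 < (J : Cube 1).side := fun J => (J : Cube 1).side_pos
  set m : S → ℕ := fun J => ⌊L / (J : Cube 1).side⌋₊ with hm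
  set F : S → Finset (Fin n → ℕ) := fun J =>
    Fintype.piFinset fun i => if i = 0 then {0} else Finset.range (m J) with hF
  set Q : (Σ J : S, F J) → Cube n := fun z =>
    ⟨fun i => if i = 0 then (z.1 : Cube 1).corner 0 else (z.2 : Fin n → ℕ) i * (z.1 : Cube 1).side,
      (z.1 : Cube 1).side, hside z.1⟩ with hQ
  have hFcard : ∀ J, (F J).card = m J ^ (n - 1) := by
    intro J
    rw [hF, Fintype.card_piFinset, ← Finset.mul_prod_erase _ _ (Finset.mem_univ (0 : Fin n)),
      if_pos rfl, Finset.card_singleton, one_mul]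
    rw [Finset.prod_congr rfl (g := fun _ => m J) fun i hi => by
      rw [if_neg (Finset.ne_of_mem_erase hi), Finset.card_range]]
    simp [Finset.card_erase_of_mem]
  have hmem : ∀ z : (Σ J : S, F J), ∀ i, (z.2 : Fin n → ℕ) i ∈
      (if i = 0 then {0} else Finset.range (m z.1) : Finset ℕ) := fun z i =>
    Fintype.mem_piFinset.1 z.2.2 i
  have hQd : Pairwise (Function.onFun Disjoint fun z => (Q z).toSet) := by
    rintro ⟨J, k⟩ ⟨J', k'⟩ hne
    refine Set.disjoint_left.2 fun x hx hx' => ?_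
    by_cases hJ : J = J'
    · subst hJ
      have hkk : (k : Fin n → ℕ) ≠ k' := fun h => hne (by rw [Subtype.ext h])
      obtain ⟨i, hi⟩ := Function.ne_iff.1 hkk
      have hi0 : i ≠ 0 := by
        rintro rfl
        have h1 := hmem ⟨J, k⟩ 0
        have h2 := hmem ⟨J, k'⟩ 0
        simp only [if_true, Finset.mem_singleton] at h1 h2
        exact hi (h1.trans h2.symm)
      have h1 := hx i trivial
      have h2 := hx' i trivial
      simp only [hQ, if_neg hi0, Set.mem_Ico] at h1 h2
      have hs := hside J
      rcases lt_or_gt_of_ne hi with h | h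
      · have h' : ((k : Fin n → ℕ) i : ℝ) + 1 ≤ (k' : Fin n → ℕ) i := by exact_mod_cast h
        nlinarith [mul_le_mul_of_nonneg_right h' hs.le]
      · have h' : ((k' : Fin n → ℕ) i : ℝ) + 1 ≤ (k : Fin n → ℕ) i := by exact_mod_cast h
        nlinarith [mul_le_mul_of_nonneg_right h' hs.le]
    · have hd : Disjoint (J : Cube 1).toSet (J' : Cube 1).toSet :=
        hS.2.1 J.2 J'.2 fun h => hJ (Subtype.ext h)
      have h1 := hx 0 trivial
      have h2 := hx' 0 trivial
      simp only [hQ, if_true] at h1 h2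
      have hJx : (fun _ => x 0) ∈ (J : Cube 1).toSet := fun i _ => by
        rw [Subsingleton.elim i 0]
        exact h1
      have hJx' : (fun _ => x 0) ∈ (J' : Cube 1).toSet := fun i _ => by
        rw [Subsingleton.elim i 0]
        exact h2
      exact Set.disjoint_left.1 hd hJx hJx'
  have hQX : ∀ z, (Q z).toSet ⊆ closedBox n L := by
    rintro ⟨J, k⟩ x hx i
    have h1 := hx i trivial
    have hs := hside J
    rcases eq_or_ne i 0 with rfl | hi
    · simp only [hQ, if_true, Set.mem_Ico] at h1
      exact ⟨(hcor J).trans h1.1, (h1.2.trans_le (hend J)).le⟩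
    · simp only [hQ, if_neg hi, Set.mem_Ico] at h1
      have h2 := hmem ⟨J, k⟩ i
      rw [if_neg hi, Finset.mem_range] at h2
      have h3 : ((k : Fin n → ℕ) i : ℝ) + 1 ≤ m J := by exact_mod_cast h2
      have hL0 : 0 ≤ L := by linarith [hcor J, hend J]
      have h4 : (m J : ℝ) * (J : Cube 1).side ≤ L :=
        (le_div_iff₀ hs).1 (Nat.floor_le (div_nonneg hL0 hs.le))
      have h5 := mul_le_mul_of_nonneg_right h3 hs.le
      have h6 : (0 : ℝ) ≤ (k : Fin n → ℕ) i * (J : Cube 1).side := by positivity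
      exact ⟨by linarith, by linarith⟩
  have hJint : ∀ J : S, IntegrableOn f
      (Set.Ico ((J : Cube 1).corner 0) ((J : Cube 1).corner 0 + (J : Cube 1).side)) := fun J =>
    hf.mono_set fun y hy => ⟨(hcor J).trans hy.1, (hy.2.trans_le (hend J)).le⟩
  refine ⟨Set.range Q, isDisjointFamily_range Q hQd hQX, ?_, ?_⟩
  · rintro _ ⟨z, rfl⟩
    exact ⟨z.1, z.1.2, rfl⟩
  rw [← tsum_cubeEnergy_eq_jnSum p _ Q hQd, jnSum_eq_tsum_cubeEnergy, ENNReal.tsum_sigma',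
    ← ENNReal.tsum_mul_left]
  refine ENNReal.tsum_le_tsum fun J => ?_
  have hE : ∀ k : F J, cubeEnergy p (fun x : Fin n → ℝ => f (x 0)) (Q ⟨J, k⟩) =
      ENNReal.ofReal (J : Cube 1).side ^ (n - 1) *
        cubeEnergy p (fun x : Fin 1 → ℝ => f (x 0)) (J : Cube 1) := by
    intro k
    rw [cubeEnergy_comp_zero p (u := f) (Q := Q ⟨J, k⟩) (by simpa [hQ] using hJint J),
      cubeEnergy_comp_zero p (hJint J)]
    simp [hQ]
  simp_rw [hE]
  rw [tsum_fintype (L := .unconditional _), Finset.sum_const, Finset.card_univ, Fintype.card_coe,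
    hFcard, nsmul_eq_mul, ← mul_assoc]
  gcongr ?_ * _
  rw [Nat.cast_pow, ← mul_pow]
  gcongr
  exact ofReal_half_le_floor_mul (hside J) (by linarith [hcor J, hend J])

lemma jnSum_hat_eq {p L : ℝ} (f : ℝ → ℝ) {T : Set (Cube n)}
    (hT : IsDisjointFamily (closedBox n L) T) :
    jnSum p (hat n L f) T = jnSum p (fun x => f (x 0)) T := by
  simp only [jnSum_eq_tsum_cubeEnergy]
  refine tsum_congr fun Q => cubeEnergy_congr (ae_of_all _ fun x hx => ?_)
  exact if_pos (hT.2.2 Q Q.2 hx)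

lemma integrableOn_closedInterval {L : ℝ} {f : ℝ → ℝ} (hf : IntegrableOn f (Set.Icc 0 L)) :
    IntegrableOn (fun x : Fin 1 → ℝ => f (x 0)) (closedInterval L) := by
  have : closedInterval L = Set.univ.pi fun _ => Set.Icc 0 L := by
    ext x
    exact ⟨fun h i _ => h i, fun h i => h i trivial⟩
  rw [this]
  exact integrableOn_pi_comp_zero (fun _ => by simp) hf

/-- The approximants of `f̂` are uniformly continuous on `[0, L]ⁿ`, which makes their sums over
families of small cubes small; stacking transfers this to `f`. -/
lemma memVJNInterval_of_memVJN_hat {p L : ℝ} (hp : 1 < p) (hL : 0 < L) {f : ℝ → ℝ}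
    (hf : IntegrableOn f (Set.Icc 0 L)) (hV : MemVJN p (hat n L f)) : MemVJNInterval p L f := by
  have hp0 : 0 < p := by linarith
  set c := ENNReal.ofReal (L / 2) ^ (n - 1) with hc
  have hc0 : c ≠ 0 := pow_ne_zero _ (by simpa using hL)
  have hct : c ≠ ⊤ := ENNReal.pow_ne_top ENNReal.ofReal_ne_top
  obtain ⟨⟨hli, hfin⟩, happ⟩ := hV
  have hmono : ∀ {T : Set (Cube n)}, IsDisjointFamily (closedBox n L) T →
      IsDisjointFamily Set.univ T := fun hT => ⟨hT.1, hT.2.1, fun _ _ => Set.subset_univ _⟩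
  refine ⟨⟨integrableOn_closedInterval hf, ?_⟩, ENNReal.tendsto_nhds_zero.2 fun ε hε => ?_⟩
  · refine (jnNorm_le (K := jnNorm p Set.univ (hat n L f) ^ p / c) hp0 fun S hS => ?_).trans_lt ?_
    · obtain ⟨T, hT, -, hle⟩ := exists_stacked_family (n := n) (p := p) hf hS
      rw [ENNReal.le_div_iff_mul_le (Or.inl hc0) (Or.inl hct), mul_comm]
      refine hle.trans ?_
      rw [← jnSum_hat_eq f hT]
      exact jnSum_le_jnNorm_rpow hp0 (hmono hT)
    · exact ENNReal.rpow_lt_top_of_nonneg (by positivity)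
        (ENNReal.div_ne_top (ENNReal.rpow_ne_top_of_nonneg hp0.le hfin.ne) hc0)
  · rcases eq_or_ne ε ⊤ with rfl | hεt
    · exact Eventually.of_forall fun _ => le_top
    have h2 : (2 : ℝ≥0∞) ^ p ≠ 0 := by simp
    have h2' : (2 : ℝ≥0∞) ^ p ≠ ⊤ := ENNReal.rpow_ne_top_of_nonneg hp0.le (by simp)
    set δ := c * ε / 2 ^ p with hδ
    have hδ0 : δ ≠ 0 := ENNReal.div_ne_zero.2 ⟨mul_ne_zero hc0 hε.ne', h2'⟩
    have hδt : δ ≠ ⊤ := ENNReal.div_ne_top (ENNReal.mul_ne_top hct hεt) h2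
    obtain ⟨g, ⟨hgs, -⟩, hgJ, hg⟩ := happ (δ ^ (1 / p))
      (pos_iff_ne_zero.2 (by simp [hδ0, hδt]))
    obtain ⟨a, ha, H⟩ := exists_forall_jnSum_le_of_continuous (L := L) hp0 hgs.continuous hδ0
    filter_upwards [Ioc_mem_nhdsGT ha] with r hr
    refine iSup_le fun S => iSup₂_le fun hS hSr => ?_
    obtain ⟨T, hT, hTside, hle⟩ := exists_stacked_family (n := n) (p := p) hf hS
    have hTa : ∀ Q ∈ T, Q.side ≤ a := by
      intro Q hQ
      obtain ⟨J, hJ, hQJ⟩ := hTside Q hQ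
      rw [hQJ]
      exact (hSr J hJ).trans hr.2
    have hsub : LocallyIntegrable fun x => hat n L f x - g x := hli.sub hgJ.1
    rw [← ENNReal.mul_le_mul_iff_right hc0 hct]
    calc c * jnSum p (fun x => f (x 0)) S
        ≤ jnSum p (hat n L f) T := hle.trans_eq (jnSum_hat_eq f hT).symm
      _ = jnSum p (fun x => (hat n L f x - g x) + g x) T := by simp only [sub_add_cancel]
      _ ≤ 2 ^ (p - 1) * (jnSum p (fun x => hat n L f x - g x) T + jnSum p g T) :=
          jnSum_add_le hp.le (fun Q _ => Q.integrableOn_of_locallyIntegrable hsub)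
            (fun Q _ => Q.integrableOn_of_locallyIntegrable hgJ.1)
      _ ≤ 2 ^ (p - 1) * (δ + δ) := by
          gcongr
          · refine (jnSum_le_jnNorm_rpow hp0 (hmono hT)).trans ?_
            rw [← ENNReal.le_rpow_inv_iff hp0, ← one_div]
            exact hg.le
          · exact H T hT hTa
      _ = 2 ^ p * δ := by
          rw [← two_mul, ← mul_assoc]
          congr 1
          nth_rewrite 2 [← ENNReal.rpow_one 2]
          rw [← ENNReal.rpow_add _ _ (by simp) (by simp), sub_add_cancel]
      _ = c * ε := ENNReal.mul_div_cancel h2 h2'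

end Restriction

end JohnNirenberg

end

theorem lemma5p6 (n : ℕ) [NeZero n] (p : ℝ) (hp : 1 < p) (L : ℝ) (hL : 0 < L)
    (f : ℝ → ℝ) (hf : IntegrableOn f (Set.Icc 0 L)) :
    (JohnNirenberg.MemVJN p (JohnNirenberg.hat n L f) → JohnNirenberg.MemVJNInterval p L f) ∧
    (JohnNirenberg.MemVJNInterval p L f → JohnNirenberg.SmallOnShortIntervals p L f →
      JohnNirenberg.MemCJN p (JohnNirenberg.hat n L f)) :=
  ⟨JohnNirenberg.memVJNInterval_of_memVJN_hat hp hL hf,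
    fun hV _ => JohnNirenberg.memCJN_hat hp hL hf hV⟩
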